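/- Let $R$ be a countable principal ideal domain that is not a field. Call an $R$-module $\aleph_1$-free if all of its countable submodules are free $R$-modules. (1) Let $A\neq 0$ be an associative unital (not necessarily commutative) $R$-algebra that is free as an $R$-module, and let $\lambda$ be a cardinal with $|A|<\lambda\le 2^{\aleph_0}$. Then there is a left $A$-module $G$ of cardinality $\lambda$ that is $\aleph_1$-free as an $R$-module and satisfies $\operatorname{End}_R G=A$, where $a\in A$ is identified with the scalar multiplication $a\cdot\mathrm{id}_G$; that is, the $R$-algebra homomorphism $A\to\operatorname{End}_R G$, $a\mapsto(x\mapsto ax)$, is bijective. (2) In particular (case $A=R$, $\lambda=\aleph_1$) there is an $\aleph_1$-free $R$-module $G$ of cardinality $\aleph_1$ such that $R\to\operatorname{End}_R G$, $r\mapsto r\cdot\mathrm{id}_G$, is bijective, and $G$ is indecomposable, i.e. $G\ne0$ and $G$ is not a direct sum of two nonzero submodules. (3) In particular, (2) holds for the local ring $R=\mathbb{Z}_{(p)}$, the localization of $\mathbb{Z}$ at $(p)$, for every prime number $p$. -/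

import Mathlib

open scoped Cardinal

universe u v w

/-- An `R`-module `M` is `κ`-free if every submodule of cardinality `< κ` is a free `R`-module.
For `κ = ℵ₁` this says that every countable submodule is free. -/
def IsCardFree (κ : Cardinal.{v}) (R : Type u) (M : Type v)
    [CommRing R] [AddCommGroup M] [Module R M] : Prop :=
  ∀ N : Submodule R M, #N < κ → Module.Free R N

/-- An `R`-module is indecomposable if it is nonzero and is not the direct sum of two nonzero
submodules. -/
def IsIndecomposableModule (R : Type u) (M : Type v)
    [CommRing R] [AddCommGroup M] [Module R M] : Prop :=
  Nontrivial M ∧ ∀ N K : Submodule R M, IsCompl N K → N = ⊥ ∨ K = ⊥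

/-- The `R`-algebra `A` acts on the `A`-module `G` by scalar multiplication, and this identifies `A`
with the full endomorphism algebra of the `R`-module `G`: the algebra homomorphism
`A → End_R G`, `a ↦ (x ↦ a • x)`, is bijective. -/
def IsEndAlgebra (R : Type u) (A : Type v) (G : Type w)
    [CommRing R] [Ring A] [Algebra R A] [AddCommGroup G] [Module R G] [Module A G]
    [IsScalarTower R A G] : Prop :=
  Function.Bijective (Algebra.lsmul R R G : A →ₐ[R] Module.End R G)

instance isPrime_span_natCast (p : ℕ) [hp : Fact p.Prime] :
    (Ideal.span {(p : ℤ)}).IsPrime :=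
  (Ideal.span_singleton_prime (by exact_mod_cast hp.out.ne_zero)).2
    (Nat.prime_iff_prime_int.1 hp.out)

/-- The ring `ℤ_(p)`, the localization of `ℤ` at the prime ideal `(p)`. -/
abbrev IntLocalizedAt (p : ℕ) [Fact p.Prime] : Type :=
  Localization.AtPrime (Ideal.span {(p : ℤ)})

/-! Fix a nonzero nonunit `p` of `R`. In a product of quotients `A / p ^ L`, the module `G` is
generated over `A` by the nodes of `|A|` many binary trees and by `p`-adic sums along branches. A
tree `α` carries exponents `depth α m` and an element `g = base α`, a finite combination of nodes of
trees of smaller rank. A branch `u` gives `y_u = ∑ p ^ depth α m • (node (u|m) + u m • g)`, and `G`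
also contains the tails of this sum divided by their leading power of `p`. Every finite combination
of nodes is `base α` for some `α`, and there are `λ` branches.

`ℵ₁`-freeness: countably many branches become disjoint after finite initial segments are cut off.
Replacing the nodes on the tails by branch elements is a triangular change of basis
(`linearIndependent_tailFamily`, `span_tailFamily`), so the part of `G` built on countably many
branches is free over `A`, hence over `R`; submodules of free modules over a principal ideal domain
are free.

Endomorphisms: if `u` and `u'` split at level `n`, then `y_u - y_u'` is `± p ^ depth α n • g` up to
a multiple of `p ^ depth α (n + 1)`. For an endomorphism `φ`, the image of `y_u` is described, apart
from the choice of actual branches, by a normal form from a set of size `|A| < λ`. Hence infinitely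
many `u` share one form, and pairs of them split arbitrarily late. Comparing the images of such a
pair (`NormalForm.smul_mem_of_split`, `exists_approx_of_split`) shows that `p ^ k • φ g` lies
`p`-adically close to `a • g` with `a` from a finite set. The exponents of distinct trees interleave
with growing gaps, so that no other tree disturbs this comparison. As `G` is Hausdorff, `p ^ k • φ g
= a • g` for some such `a`. This holds for all combinations `g` of nodes, which forces a common
scalar on the nodes, and the nodes generate a dense submodule. -/

/-! ### Submodules of free modules over a principal ideal domain -/

section FreeSubmodule

variable {R : Type u} [CommRing R] [IsDomain R] [IsPrincipalIdealRing R]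

/-- The leading coefficients at `i` of elements supported in `Iic i` form a principal ideal.
Elements realizing the nonzero generators are independent, by the largest index involved, and they
span, since subtracting a multiple lowers the top index and `ι` is well-ordered. -/
theorem Module.Free.of_injective_finsupp {ι N : Type*} [LinearOrder ι]
    [WellFoundedLT ι] [AddCommGroup N] [Module R N] (f : N →ₗ[R] ι →₀ R)
    (hf : Function.Injective f) : Module.Free R N := by
  classical
  let N' : ι → Submodule R N := fun i => (Finsupp.supported R R (Set.Iic i)).comap f
  let J : ι → Ideal R := fun i => (N' i).map (Finsupp.lapply i ∘ₗ f)
  let r : ι → R := fun i => Submodule.IsPrincipal.generator (J i)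
  have hr : ∀ i, ∃ x ∈ N' i, f x i = r i := fun i =>
    Submodule.mem_map.1 (Submodule.IsPrincipal.generator_mem (J i))
  choose x hx hxr using hr
  let e : {i // r i ≠ 0} → N := fun i => x i
  have hle : ∀ i j, f (x i) j ≠ 0 → j ≤ i := fun i j hj =>
    hx i (Finsupp.mem_support_iff.2 hj)
  have hli : LinearIndependent R e := by
    rw [linearIndependent_iff]
    intro l hl
    by_contra hne
    obtain ⟨i, hi, hmax⟩ := l.support.exists_max_image id (Finsupp.support_nonempty_iff.2 hne)
    have h := DFunLike.congr_fun (congrArg f hl) i.1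
    rw [Finsupp.linearCombination_apply, Finsupp.sum, map_sum,
      Finsupp.finsetSum_apply, Finset.sum_eq_single_of_mem i hi] at h
    · rw [map_smul, map_zero, Finsupp.smul_apply, hxr, smul_eq_mul, Finsupp.zero_apply] at h
      exact Finsupp.mem_support_iff.1 hi ((mul_eq_zero.1 h).resolve_right i.2)
    · intro j hj hji
      have h0 : f (x j) i = 0 := by
        by_contra h0
        exact hji (le_antisymm (hmax j hj) (hle _ _ h0))
      rw [map_smul, Finsupp.smul_apply, h0, smul_zero]
  have hspan : ∀ i, ∀ y : N, (∀ j, f y j ≠ 0 → j ≤ i) → y ∈ Submodule.span R (Set.range e) := by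
    intro i
    induction i using WellFoundedLT.induction with
    | _ i ih =>
      intro y hy
      obtain ⟨z, hz, hlt⟩ : ∃ z ∈ Submodule.span R (Set.range e),
          ∀ j, f (y - z) j ≠ 0 → j < i := by
        have hmem : f y i ∈ J i := Submodule.mem_map.2
          ⟨y, fun j hj => hy j (Finsupp.mem_support_iff.1 hj), rfl⟩
        obtain ⟨c, hc⟩ := (Submodule.IsPrincipal.mem_iff_eq_smul_generator (J i)).1 hmem
        by_cases h0 : r i = 0
        · refine ⟨0, Submodule.zero_mem _, fun j hj => ?_⟩
          rw [sub_zero] at hj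
          refine lt_of_le_of_ne (hy j hj) ?_
          rintro rfl
          apply hj
          rw [hc]
          change c * r j = 0
          rw [h0, mul_zero]
        · refine ⟨c • e ⟨i, h0⟩, Submodule.smul_mem _ _ (Submodule.subset_span ⟨_, rfl⟩),
            fun j hj => ?_⟩
          have hj' : f y j - c * f (x i) j ≠ 0 := by
            rwa [map_sub, map_smul, Finsupp.sub_apply, Finsupp.smul_apply] at hj
          refine lt_of_le_of_ne ?_ ?_
          · by_contra hji
            apply hj'
            rw [not_not.1 fun h => hji (hy j h), not_not.1 fun h => hji (hle i j h)]
            simp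
          · rintro rfl
            apply hj'
            rw [hxr, hc]
            exact sub_self _
      rw [← sub_add_cancel y z]
      refine Submodule.add_mem _ ?_ hz
      by_cases hyz : y - z = 0
      · rw [hyz]; exact Submodule.zero_mem _
      · have hsupp : (f (y - z)).support.Nonempty :=
          Finsupp.support_nonempty_iff.2 fun h => hyz ((map_eq_zero_iff f hf).1 h)
        obtain ⟨m, hm, hmax⟩ := (f (y - z)).support.exists_max_image id hsupp
        exact ih m (hlt m (Finsupp.mem_support_iff.1 hm)) _
          fun j hj => hmax j (Finsupp.mem_support_iff.2 hj)
  refine Module.Free.of_basis (Module.Basis.mk hli fun y _ => ?_)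
  by_cases hy : y = 0
  · rw [hy]; exact Submodule.zero_mem _
  · obtain ⟨m, hm, hmax⟩ := (f y).support.exists_max_image id
      (Finsupp.support_nonempty_iff.2 fun h => hy ((map_eq_zero_iff f hf).1 h))
    exact hspan m y fun j hj => hmax j (Finsupp.mem_support_iff.2 hj)

/-- A submodule of a free module over a principal ideal domain is free. -/
theorem Module.Free.of_injective_of_isPrincipalIdealRing {M N : Type*} [AddCommGroup M]
    [Module R M] [AddCommGroup N] [Module R N] [Module.Free R M] (f : N →ₗ[R] M)
    (hf : Function.Injective f) : Module.Free R N := by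
  obtain ⟨_, _⟩ := exists_wellFoundedLT (Module.Free.ChooseBasisIndex R M)
  exact Module.Free.of_injective_finsupp
    ((Module.Free.chooseBasis R M).repr.toLinearMap ∘ₗ f)
    ((Module.Free.chooseBasis R M).repr.injective.comp hf)

end FreeSubmodule

/-! ### Branches and the data of the construction -/

namespace BranchModule

/-- The list of the first `n` values of a sequence. -/
def initSeg (u : ℕ → Bool) (n : ℕ) : List Bool := (List.range n).map u

@[simp]
theorem length_initSeg (u : ℕ → Bool) (n : ℕ) : (initSeg u n).length = n := by
  simp [initSeg]

theorem initSeg_eq_iff {u v : ℕ → Bool} {n m : ℕ} :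
    initSeg u n = initSeg v m ↔ n = m ∧ ∀ i < n, u i = v i := by
  constructor
  · intro h
    have hn : n = m := by simpa using congrArg List.length h
    subst hn
    refine ⟨rfl, fun i hi => ?_⟩
    have := List.map_inj_left.1 h
    exact this i (List.mem_range.2 hi)
  · rintro ⟨rfl, h⟩
    exact List.map_inj_left.2 fun i hi => h i (List.mem_range.1 hi)

theorem initSeg_eq_initSeg {u v : ℕ → Bool} {n m : ℕ} (hnm : n ≤ m)
    (h : initSeg u m = initSeg v m) : initSeg u n = initSeg v n :=
  initSeg_eq_iff.2 ⟨rfl, fun i hi => (initSeg_eq_iff.1 h).2 i (hi.trans_le hnm)⟩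

/-- Combinatorial data for a module generated over a forest of binary trees. The trees are indexed
by `Λ`, the branches used in each tree by `I`; `depth α n` is the exponent attached to the `n`-th
level of the tree `α`, and `base α` is the element that the branches of the tree `α` make
divisible. -/
structure BranchSystem (A : Type v) [Ring A] (Λ I : Type v) where
  branch : I → ℕ → Bool
  branch_injective : Function.Injective branch
  depth : Λ → ℕ → ℕ
  depth_add_lt : ∀ α n, depth α n + n < depth α (n + 1)
  depth_gap : ∀ α β m n, depth β (m + 1) < depth α (n + 1) →
    depth β (m + 1) + n ≤ depth α (n + 1)
  depth_interleave : ∀ α β, ∃ n₁, ∀ n ≥ n₁, ∀ m, depth α (n + 1) ≤ depth β (m + 1) →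
    (α = β ∧ m = n) ∨ depth α n + n ≤ depth β m
  rank : Λ → ℕ
  base : Λ → (Λ × List Bool →₀ A)
  rank_lt_of_mem_support : ∀ α, ∀ τ ∈ (base α).support, rank τ.1 < rank α

/-- The left ideal `p ^ L • A`. -/
def powSubmodule {R : Type u} [CommRing R] (p : R) (A : Type v) [Ring A] [Algebra R A] (L : ℕ) :
    Submodule A A where
  carrier := {a | ∃ b, a = p ^ L • b}
  add_mem' := by
    rintro _ _ ⟨b, rfl⟩ ⟨c, rfl⟩
    exact ⟨b + c, (smul_add _ _ _).symm⟩
  zero_mem' := ⟨0, (smul_zero _).symm⟩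
  smul_mem' := by
    rintro c _ ⟨b, rfl⟩
    exact ⟨c * b, by simp⟩

/-- The quotient of `A` by `p ^ L • A`, as a left `A`-module. -/
def Residue {R : Type u} [CommRing R] (p : R) (A : Type v) [Ring A] [Algebra R A] (L : ℕ) :
    Type v :=
  A ⧸ powSubmodule p A L

section Residue

variable {R : Type u} [CommRing R] {p : R} {A : Type v} [Ring A] [Algebra R A] {L : ℕ}

instance : AddCommGroup (Residue p A L) :=
  inferInstanceAs (AddCommGroup (A ⧸ powSubmodule p A L))

instance : Module A (Residue p A L) :=
  inferInstanceAs (Module A (A ⧸ powSubmodule p A L))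

instance : Module R (Residue p A L) :=
  inferInstanceAs (Module R (A ⧸ powSubmodule p A L))

instance : IsScalarTower R A (Residue p A L) :=
  inferInstanceAs (IsScalarTower R A (A ⧸ powSubmodule p A L))

variable (p L) in
/-- The residue class modulo `p ^ L`. -/
def residue : A →ₗ[A] Residue p A L := (powSubmodule p A L).mkQ

theorem residue_surjective : Function.Surjective (residue (A := A) p L) :=
  (powSubmodule p A L).mkQ_surjective

theorem residue_eq_zero {a : A} : residue p L a = 0 ↔ a ∈ powSubmodule p A L :=
  Submodule.Quotient.mk_eq_zero _

theorem residue_eq_residue {a b : A} : residue p L a = residue p L b ↔ a - b ∈ powSubmodule p A L :=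
  Submodule.Quotient.eq _

theorem residue_smul (r : R) (a : A) : residue p L (r • a) = r • residue p L a := rfl

instance : SMulCommClass R A (Residue p A L) where
  smul_comm r a x := by
    obtain ⟨b, rfl⟩ := residue_surjective x
    rw [← map_smul, ← residue_smul, ← residue_smul, ← map_smul, smul_comm]

end Residue

/-- The product of the quotients `A / p ^ L`, in which the module of branches is realized. -/
abbrev Ambient {R : Type u} [CommRing R] (p : R) (A : Type v) [Ring A] [Algebra R A]
    (Λ : Type v) : Type v :=
  (x : (Λ × List Bool) × ℕ) → Residue p A x.2

/-! ### Branch elements as `p`-adic sums -/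

section Ambient

variable {R : Type u} [CommRing R] {p : R} {A : Type v} [Ring A] [Algebra R A] {Λ I : Type v}

theorem pow_smul_mem_powSubmodule {L k : ℕ} (h : L ≤ k) (a : A) :
    p ^ k • a ∈ powSubmodule p A L :=
  ⟨p ^ (k - L) • a, by rw [smul_smul, ← pow_add, Nat.add_sub_cancel' h]⟩

theorem pow_smul_quotient_eq_zero {L k : ℕ} (h : L ≤ k) (x : Residue p A L) :
    p ^ k • x = 0 := by
  obtain ⟨a, rfl⟩ := residue_surjective x
  rw [← residue_smul, residue_eq_zero]
  exact pow_smul_mem_powSubmodule h a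

/-- The element of the ambient module given by a family of elements of `A`. -/
def constFamily (p : R) (f : Λ × List Bool → A) : Ambient p A Λ :=
  fun x => residue p x.2 (f x.1)

open Classical in
/-- The unit vector of a node. -/
noncomputable def node (p : R) (A : Type v) [Ring A] [Algebra R A] (τ : Λ × List Bool) :
    Ambient p A Λ :=
  constFamily p fun σ => if σ = τ then 1 else 0

open Classical in
/-- The partial sums that represent a branch element modulo `p ^ L`. -/
noncomputable def approx (p : R) (S : BranchSystem A Λ I) (α : Λ) (u : I) (n : ℕ)
    (τ : Λ × List Bool) (L : ℕ) : A :=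
  ∑ m ∈ Finset.range L, p ^ (S.depth α (n + m) - S.depth α n) •
    ((if τ = (α, initSeg (S.branch u) (n + m)) then 1 else 0) +
      if S.branch u (n + m) then S.base α τ else 0)

/-- The branch element `∑ m ≥ n, p ^ (depth m - depth n) • (node m + u m • base)`. -/
noncomputable def branchElt (p : R) (S : BranchSystem A Λ I) (α : Λ) (u : I) (n : ℕ) :
    Ambient p A Λ :=
  fun x => residue p x.2 (approx p S α u n x.1 x.2)

variable (S : BranchSystem A Λ I)

theorem BranchSystem.depth_strictMono (α : Λ) : StrictMono (S.depth α) :=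
  strictMono_nat_of_lt_succ fun n => by have := S.depth_add_lt α n; omega

theorem BranchSystem.le_depth (α : Λ) (n : ℕ) : n ≤ S.depth α n :=
  (S.depth_strictMono α).le_apply

theorem BranchSystem.add_depth_le (α : Λ) (n m : ℕ) : m + S.depth α n ≤ S.depth α (m + n) :=
  (S.depth_strictMono α).add_le_nat m n

theorem constFamily_base (α : Λ) :
    constFamily p (S.base α) = (S.base α).sum fun τ a => a • node p A τ := by
  classical
  ext x
  rw [Finsupp.sum, Finset.sum_apply]
  simp only [Pi.smul_apply, node, constFamily, ← map_smul, ← map_sum]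
  congr 1
  simp [Finset.sum_ite_eq]

theorem branchElt_succ (α : Λ) (u : I) (n : ℕ) :
    branchElt p S α u n = node p A (α, initSeg (S.branch u) n) +
      (if S.branch u n then (1 : R) else 0) • constFamily p (S.base α) +
      p ^ (S.depth α (n + 1) - S.depth α n) • branchElt p S α u (n + 1) := by
  classical
  ext ⟨τ, L⟩
  have key : ∀ m, p ^ (S.depth α (n + 1) - S.depth α n) *
      p ^ (S.depth α (n + 1 + m) - S.depth α (n + 1)) =
      p ^ (S.depth α (n + (m + 1)) - S.depth α n) := by
    intro m
    rw [← pow_add]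
    have h1 := (S.depth_strictMono α).monotone (show n ≤ n + 1 by omega)
    have h2 := (S.depth_strictMono α).monotone (show n + 1 ≤ n + 1 + m by omega)
    have h3 : n + (m + 1) = n + 1 + m := by omega
    rw [h3]
    congr 1
    omega
  have hs : approx p S α u n τ (L + 1) =
      (if τ = (α, initSeg (S.branch u) n) then 1 else 0) +
      (if S.branch u n then (1 : R) else 0) • S.base α τ +
      p ^ (S.depth α (n + 1) - S.depth α n) • approx p S α u (n + 1) τ L := by
    rw [approx, Finset.sum_range_succ', add_comm]
    congr 1
    · simp
    · rw [approx, Finset.smul_sum]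
      refine Finset.sum_congr rfl fun m _ => ?_
      rw [smul_smul, key]
      have h3 : n + (m + 1) = n + 1 + m := by omega
      simp only [h3]
  -- The extra summand is needed for the index shift; it vanishes modulo `p ^ L` because exponents
  -- grow by at least one per level.
  have hd : residue p L (approx p S α u n τ (L + 1)) =
      residue p L (approx p S α u n τ L) := by
    rw [residue_eq_residue, approx, approx, Finset.sum_range_succ, add_sub_cancel_left]
    apply pow_smul_mem_powSubmodule
    have := S.add_depth_le α n L
    rw [add_comm n L]
    omega
  change residue p L (approx p S α u n τ L) = _
  rw [← hd, hs]
  rfl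

open Classical in
theorem branchElt_apply (α : Λ) (u : I) (n : ℕ) (τ : Λ × List Bool) (L : ℕ)
    (h : S.base α τ = 0) :
    branchElt p S α u n (τ, L) = residue p L
      (if τ = (α, initSeg (S.branch u) τ.2.length) ∧ n ≤ τ.2.length then
        p ^ (S.depth α τ.2.length - S.depth α n) • 1 else 0) := by
  have hz : ∀ m, (τ = (α, initSeg (S.branch u) (n + m))) ↔
      ((τ = (α, initSeg (S.branch u) τ.2.length) ∧ n ≤ τ.2.length) ∧ m = τ.2.length - n) := by
    intro m
    constructor
    · intro e
      have hl : τ.2.length = n + m := by rw [e]; simp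
      rw [hl]
      exact ⟨⟨e, by omega⟩, by omega⟩
    · rintro ⟨⟨e, hn⟩, rfl⟩
      rwa [Nat.add_sub_cancel' hn]
  change residue p L (approx p S α u n τ L) = _
  rw [approx]
  simp only [h, ite_self, add_zero, hz]
  by_cases hc : τ = (α, initSeg (S.branch u) τ.2.length) ∧ n ≤ τ.2.length
  · rw [if_pos hc]
    simp only [eq_true hc, true_and, smul_ite, smul_zero]
    rw [Finset.sum_ite_eq']
    split_ifs with hm
    · rw [Nat.add_sub_cancel' hc.2]
    · symm
      rw [map_zero, residue_eq_zero]
      apply pow_smul_mem_powSubmodule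
      have hL : L ≤ τ.2.length - n := by simpa using hm
      have := S.add_depth_le α n (τ.2.length - n)
      rw [Nat.sub_add_cancel hc.2] at this
      omega
  · simp [hc]

end Ambient

/-! ### Freeness over countably many branches -/

section Free

variable {R : Type u} [CommRing R] {p : R} {A : Type v} [Ring A] [Algebra R A] {Λ I : Type v}
  (S : BranchSystem A Λ I)

/-- The `A`-submodule generated by all nodes and by the branch elements with index in `C`. -/
noncomputable def spanOn (p : R) (S : BranchSystem A Λ I) (C : Set I) :
    Submodule A (Ambient p A Λ) :=
  Submodule.span A (Set.range (node p A) ∪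
    {x | ∃ α, ∃ u ∈ C, ∃ n, branchElt p S α u n = x})

theorem node_mem_spanOn (C : Set I) (τ : Λ × List Bool) : node p A τ ∈ spanOn p S C :=
  Submodule.subset_span (Or.inl ⟨τ, rfl⟩)

theorem branchElt_mem_spanOn {C : Set I} (α : Λ) {u : I} (hu : u ∈ C) (n : ℕ) :
    branchElt p S α u n ∈ spanOn p S C :=
  Submodule.subset_span (Or.inr ⟨α, u, hu, n, rfl⟩)

theorem spanOn_mono {C D : Set I} (h : C ⊆ D) : spanOn p S C ≤ spanOn p S D := by
  apply Submodule.span_mono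
  rintro x (hx | ⟨α, u, hu, n, rfl⟩)
  · exact Or.inl hx
  · exact Or.inr ⟨α, u, h hu, n, rfl⟩

theorem constFamily_base_mem_spanOn (C : Set I) (α : Λ) :
    constFamily p (S.base α) ∈ spanOn p S C := by
  rw [constFamily_base]
  exact Submodule.sum_mem _ fun τ _ => Submodule.smul_mem _ _ (node_mem_spanOn S C τ)

theorem exists_finite_mem_spanOn {x : Ambient p A Λ} (hx : x ∈ spanOn p S Set.univ) :
    ∃ C : Set I, C.Finite ∧ x ∈ spanOn p S C := by
  induction hx using Submodule.span_induction with
  | mem x hx =>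
    rcases hx with ⟨τ, rfl⟩ | ⟨α, u, -, n, rfl⟩
    · exact ⟨∅, Set.finite_empty, node_mem_spanOn S _ τ⟩
    · exact ⟨{u}, Set.finite_singleton u, branchElt_mem_spanOn S α (Set.mem_singleton u) n⟩
  | zero => exact ⟨∅, Set.finite_empty, Submodule.zero_mem _⟩
  | add x y _ _ hx hy =>
    obtain ⟨C, hC, hx⟩ := hx
    obtain ⟨D, hD, hy⟩ := hy
    exact ⟨C ∪ D, hC.union hD, Submodule.add_mem _
      (spanOn_mono S Set.subset_union_left hx) (spanOn_mono S Set.subset_union_right hy)⟩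
  | smul a x _ hx =>
    obtain ⟨C, hC, hx⟩ := hx
    exact ⟨C, hC, Submodule.smul_mem _ _ hx⟩

theorem exists_initSeg_ne {u v : ℕ → Bool} (h : u ≠ v) :
    ∃ k, ∀ n ≥ k, initSeg u n ≠ initSeg v n := by
  obtain ⟨i, hi⟩ := Function.ne_iff.1 h
  exact ⟨i + 1, fun n hn e => hi ((initSeg_eq_iff.1 e).2 i (by omega))⟩

/-- Countably many branches become disjoint after removing finite initial segments. -/
theorem exists_threshold {C : Set I} (hC : C.Countable) :
    ∃ k : I → ℕ, ∀ u ∈ C, ∀ v ∈ C, ∀ n, k u ≤ n → k v ≤ n →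
      initSeg (S.branch u) n = initSeg (S.branch v) n → u = v := by
  classical
  obtain ⟨f, hf⟩ := Set.countable_iff_exists_injOn.1 hC
  have sep : ∀ u v : I, ∃ k, u ≠ v → ∀ n ≥ k,
      initSeg (S.branch u) n ≠ initSeg (S.branch v) n := by
    intro u v
    by_cases h : u = v
    · exact ⟨0, fun h' => absurd h h'⟩
    · obtain ⟨k, hk⟩ := exists_initSeg_ne (S.branch_injective.ne h)
      exact ⟨k, fun _ => hk⟩
  choose d hd using sep
  -- Only the finitely many branches enumerated no later than `u` constrain `k u`; each pair is
  -- separated by the later of its two members.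
  have bound : ∀ u : I, ∃ k, ∀ v ∈ C, f v ≤ f u → d u v ≤ k := by
    intro u
    have hfin : {v | v ∈ C ∧ f v ≤ f u}.Finite :=
      Set.Finite.of_finite_image ((Set.finite_Iic (f u)).subset (by
        rintro _ ⟨v, hv, rfl⟩
        exact hv.2)) (hf.mono fun v hv => hv.1)
    obtain ⟨k, hk⟩ := (hfin.image (d u)).bddAbove
    exact ⟨k, fun v hv hvu => hk ⟨v, ⟨hv, hvu⟩, rfl⟩⟩
  choose k hk using bound
  refine ⟨k, fun u hu v hv n hun hvn e => ?_⟩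
  by_contra hne
  rcases le_total (f v) (f u) with h | h
  · exact hd u v hne n ((hk u v hv h).trans hun) e
  · exact hd v u (Ne.symm hne) n ((hk v u hu h).trans hvn) e.symm

open Classical in
/-- Replace the nodes on the tails of the branches in `C` by the corresponding branch elements. -/
noncomputable def tailFamily (p : R) (S : BranchSystem A Λ I) (C : Set I) (k : I → ℕ)
    (τ : Λ × List Bool) : Ambient p A Λ :=
  if h : ∃ u ∈ C, k u ≤ τ.2.length ∧ initSeg (S.branch u) τ.2.length = τ.2 then
    branchElt p S τ.1 h.choose τ.2.length
  else node p A τ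

theorem tailFamily_cases (C : Set I) (k : I → ℕ) (τ : Λ × List Bool) :
    (∃ u ∈ C, initSeg (S.branch u) τ.2.length = τ.2 ∧
      tailFamily p S C k τ = branchElt p S τ.1 u τ.2.length) ∨
    tailFamily p S C k τ = node p A τ := by
  classical
  rw [tailFamily]
  split_ifs with h
  · exact Or.inl ⟨h.choose, h.choose_spec.1, h.choose_spec.2.2, rfl⟩
  · exact Or.inr rfl

theorem tailFamily_eq_branchElt {C : Set I} {k : I → ℕ}
    (hk : ∀ u ∈ C, ∀ v ∈ C, ∀ n, k u ≤ n → k v ≤ n →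
      initSeg (S.branch u) n = initSeg (S.branch v) n → u = v)
    (α : Λ) {u : I} (hu : u ∈ C) {n : ℕ} (hn : k u ≤ n) :
    tailFamily p S C k (α, initSeg (S.branch u) n) = branchElt p S α u n := by
  have h : ∃ v ∈ C, k v ≤ (initSeg (S.branch u) n).length ∧
      initSeg (S.branch v) (initSeg (S.branch u) n).length = initSeg (S.branch u) n :=
    ⟨u, hu, by simpa using hn, by simp⟩
  have e : tailFamily p S C k (α, initSeg (S.branch u) n) =
      branchElt p S α h.choose (initSeg (S.branch u) n).length := dif_pos h
  have h1 := h.choose_spec.2.1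
  have h2 := h.choose_spec.2.2
  rw [e, hk _ h.choose_spec.1 u hu n (by simpa using h1) hn (by simpa using h2), length_initSeg]

theorem tailFamily_eq_node {C : Set I} {k : I → ℕ} (τ : Λ × List Bool)
    (h : ∀ u ∈ C, k u ≤ τ.2.length → initSeg (S.branch u) τ.2.length ≠ τ.2) :
    tailFamily p S C k τ = node p A τ :=
  dif_neg fun ⟨u, hu, h1, h2⟩ => h u hu h1 h2

theorem node_apply_self (τ : Λ × List Bool) (L : ℕ) :
    node p A τ (τ, L) = residue p L 1 := by
  simp [node, constFamily]

theorem node_apply_of_ne {σ τ : Λ × List Bool} (h : σ ≠ τ) (L : ℕ) :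
    node p A τ (σ, L) = 0 := by
  simp [node, constFamily, h]

theorem BranchSystem.base_eq_zero {α : Λ} {τ : Λ × List Bool} (h : S.rank α ≤ S.rank τ.1) :
    S.base α τ = 0 := by
  by_contra hne
  have := S.rank_lt_of_mem_support α τ (Finsupp.mem_support_iff.2 hne)
  omega

theorem tailFamily_apply_self (C : Set I) (k : I → ℕ) (τ : Λ × List Bool) (L : ℕ) :
    tailFamily p S C k τ (τ, L) = residue p L 1 := by
  rcases tailFamily_cases (p := p) S C k τ with ⟨u, -, h, e⟩ | e
  · rw [e, branchElt_apply S _ _ _ _ _ (S.base_eq_zero le_rfl), if_pos ⟨by rw [h], le_rfl⟩]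
    simp
  · rw [e, node_apply_self]

theorem tailFamily_apply_of_ne (C : Set I) (k : I → ℕ) {σ τ : Λ × List Bool} (hne : σ ≠ τ)
    (hr : S.rank τ.1 ≤ S.rank σ.1)
    (hl : S.rank τ.1 = S.rank σ.1 → σ.2.length ≤ τ.2.length) (L : ℕ) :
    tailFamily p S C k τ (σ, L) = 0 := by
  rcases tailFamily_cases (p := p) S C k τ with ⟨u, -, h, e⟩ | e
  · rw [e, branchElt_apply S _ _ _ _ _ (S.base_eq_zero hr), if_neg]
    · exact map_zero _
    · rintro ⟨h1, h2⟩
      have h3 : σ.1 = τ.1 := (Prod.ext_iff.1 h1).1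
      have h4 : σ.2.length = τ.2.length := le_antisymm (hl (by rw [h3])) h2
      apply hne
      rw [h1, h4, h]
  · rw [e, node_apply_of_ne hne]

theorem eq_zero_of_forall_residue (hsep : ∀ a : A, (∀ L, a ∈ powSubmodule p A L) → a = 0) {a : A}
    (h : ∀ L, residue p L a = 0) : a = 0 :=
  hsep a fun L => residue_eq_zero.1 (h L)

/-- The family is triangular: its member at `τ` has coefficient 1 at `τ` and otherwise involves only
longer nodes of the same tree and nodes of smaller rank. In a relation, a node of maximal rank and
then of minimal length therefore meets only its own coefficient. -/
theorem linearIndependent_tailFamily (hsep : ∀ a : A, (∀ L, a ∈ powSubmodule p A L) → a = 0)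
    (C : Set I) (k : I → ℕ) : LinearIndependent A (tailFamily p S C k) := by
  classical
  rw [linearIndependent_iff]
  intro l hl
  by_contra hne
  have hs : l.support.Nonempty := Finsupp.support_nonempty_iff.2 hne
  obtain ⟨ρ, hρ, hρmax⟩ := l.support.exists_max_image (fun τ => S.rank τ.1) hs
  obtain ⟨σ, hσ, hσmin⟩ := (l.support.filter fun τ => S.rank τ.1 = S.rank ρ.1).exists_min_image
    (fun τ => τ.2.length) ⟨ρ, Finset.mem_filter.2 ⟨hρ, rfl⟩⟩
  rw [Finset.mem_filter] at hσ
  apply Finsupp.mem_support_iff.1 hσ.1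
  apply eq_zero_of_forall_residue hsep
  intro L
  have := congrFun hl (σ, L)
  rw [Finsupp.linearCombination_apply, Finsupp.sum, Finset.sum_apply,
    Finset.sum_eq_single_of_mem σ hσ.1] at this
  · rw [Pi.smul_apply, tailFamily_apply_self, ← map_smul] at this
    simpa using this
  · intro τ hτ hτσ
    rw [Pi.smul_apply, tailFamily_apply_of_ne S C k hτσ.symm, smul_zero]
    · rw [hσ.2]; exact hρmax τ hτ
    · intro hr
      exact hσmin τ (Finset.mem_filter.2 ⟨hτ, by rw [hr, hσ.2]⟩)

/-- By `branchElt_succ`, a replaced node is recovered from two consecutive branch elements and the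
base element, which has smaller rank; hence the induction on rank. Branch elements below the
threshold then follow by descending along the branch. -/
theorem span_tailFamily {C : Set I} {k : I → ℕ}
    (hk : ∀ u ∈ C, ∀ v ∈ C, ∀ n, k u ≤ n → k v ≤ n →
      initSeg (S.branch u) n = initSeg (S.branch v) n → u = v) :
    Submodule.span A (Set.range (tailFamily p S C k)) = spanOn p S C := by
  apply le_antisymm
  · rw [Submodule.span_le]
    rintro _ ⟨τ, rfl⟩
    rcases tailFamily_cases (p := p) S C k τ with ⟨u, hu, -, e⟩ | e
    · rw [e]; exact branchElt_mem_spanOn S _ hu _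
    · rw [e]; exact node_mem_spanOn S _ _
  set M := Submodule.span A (Set.range (tailFamily p S C k)) with hM
  have htail : ∀ α, ∀ u ∈ C, ∀ n, k u ≤ n → branchElt p S α u n ∈ M := fun α u hu n hn =>
    Submodule.subset_span ⟨_, tailFamily_eq_branchElt S hk α hu hn⟩
  have hbase : ∀ α, (∀ τ : Λ × List Bool, S.rank τ.1 < S.rank α → node p A τ ∈ M) →
      constFamily p (S.base α) ∈ M := by
    intro α h
    rw [constFamily_base]
    exact Submodule.sum_mem _ fun τ hτ =>
      Submodule.smul_mem _ _ (h τ (S.rank_lt_of_mem_support α τ hτ))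
  have hRmem : ∀ (r : R) {x}, x ∈ M → r • x ∈ M := fun r x hx =>
    Submodule.smul_of_tower_mem M r hx
  have hnode : ∀ j, ∀ τ : Λ × List Bool, S.rank τ.1 = j → node p A τ ∈ M := by
    intro j
    induction j using Nat.strong_induction_on with
    | _ j ih =>
      intro τ hτ
      by_cases h : ∃ u ∈ C, k u ≤ τ.2.length ∧ initSeg (S.branch u) τ.2.length = τ.2
      · obtain ⟨u, hu, h1, h2⟩ := h
        have e := branchElt_succ (p := p) S τ.1 u τ.2.length
        rw [h2, add_assoc] at e
        rw [← sub_eq_iff_eq_add] at e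
        change _ = node p A τ at e
        rw [← e]
        refine Submodule.sub_mem _ (htail _ u hu _ h1) (Submodule.add_mem _ (hRmem _ ?_)
          (hRmem _ (htail _ u hu _ (by omega))))
        exact hbase _ fun σ hσ => ih _ (hτ ▸ hσ) σ rfl
      · rw [← tailFamily_eq_node (p := p) S (C := C) (k := k) τ
          fun u hu h1 h2 => h ⟨u, hu, h1, h2⟩]
        exact Submodule.subset_span ⟨τ, rfl⟩
  rw [spanOn, Submodule.span_le]
  rintro _ (⟨τ, rfl⟩ | ⟨α, u, hu, n, rfl⟩)
  · exact hnode _ τ rfl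
  · have hdesc : ∀ d n, k u ≤ n + d → branchElt p S α u n ∈ M := by
      intro d
      induction d with
      | zero => exact fun n hn => htail α u hu n hn
      | succ d ih =>
        intro n hn
        rw [branchElt_succ]
        exact Submodule.add_mem _ (Submodule.add_mem _ (hnode _ _ rfl)
          (hRmem _ (hbase _ fun σ _ => hnode _ σ rfl))) (hRmem _ (ih (n + 1) (by omega)))
    exact hdesc (k u) n (by omega)

theorem free_spanOn (hsep : ∀ a : A, (∀ L, a ∈ powSubmodule p A L) → a = 0)
    {C : Set I} (hC : C.Countable) : Module.Free A (spanOn p S C) := by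
  obtain ⟨k, hk⟩ := exists_threshold S hC
  rw [← span_tailFamily S hk]
  exact Module.Free.of_basis (Module.Basis.span (linearIndependent_tailFamily S hsep C k))

end Free

/-! ### Normal forms of elements -/

section NormalForm

variable {R : Type u} [CommRing R] {p : R} {A : Type v} [Ring A] [Algebra R A] {Λ I : Type v}
  (S : BranchSystem A Λ I)

/-- The branch element scaled so that its coefficient at level `n` is `p ^ depth n`. -/
noncomputable def fullBranch (p : R) (S : BranchSystem A Λ I) (α : Λ) (u : I) : Ambient p A Λ :=
  p ^ S.depth α 0 • branchElt p S α u 0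

theorem fullBranch_mem (α : Λ) (u : I) : fullBranch p S α u ∈ spanOn p S Set.univ :=
  Submodule.smul_of_tower_mem _ _ (branchElt_mem_spanOn S α (Set.mem_univ u) 0)

theorem fullBranch_eq (α : Λ) (u : I) (n : ℕ) :
    fullBranch p S α u = ∑ m ∈ Finset.range n, p ^ S.depth α m •
      (node p A (α, initSeg (S.branch u) m) +
        (if S.branch u m then (1 : R) else 0) • constFamily p (S.base α)) +
      p ^ S.depth α n • branchElt p S α u n := by
  induction n with
  | zero => simp [fullBranch]
  | succ n ih =>
    have h := (S.depth_strictMono α).monotone (Nat.le_succ n)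
    rw [ih, branchElt_succ S α u n, Finset.sum_range_succ, smul_add, smul_smul, ← pow_add,
      Nat.add_sub_cancel' h, add_assoc]

/-- Two branches that split at level `n` differ by a multiple of the base element, up to higher
powers of `p`. -/
theorem fullBranch_sub_fullBranch (α : Λ) {u v : I} {n : ℕ}
    (h : ∀ i < n, S.branch u i = S.branch v i) :
    fullBranch p S α u - fullBranch p S α v =
      (((if S.branch u n then (1 : R) else 0) - if S.branch v n then (1 : R) else 0) *
        p ^ S.depth α n) • constFamily p (S.base α) +
      p ^ S.depth α (n + 1) • (branchElt p S α u (n + 1) - branchElt p S α v (n + 1)) := by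
  have hseg : initSeg (S.branch u) n = initSeg (S.branch v) n := initSeg_eq_iff.2 ⟨rfl, h⟩
  have hsum : ∑ m ∈ Finset.range n, p ^ S.depth α m •
      (node p A (α, initSeg (S.branch u) m) +
        (if S.branch u m then (1 : R) else 0) • constFamily p (S.base α)) =
      ∑ m ∈ Finset.range n, p ^ S.depth α m •
      (node p A (α, initSeg (S.branch v) m) +
        (if S.branch v m then (1 : R) else 0) • constFamily p (S.base α)) := by
    refine Finset.sum_congr rfl fun m hm => ?_
    have hm := Finset.mem_range.1 hm
    rw [initSeg_eq_initSeg hm.le hseg, h m hm]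
  rw [fullBranch_eq S α u (n + 1), fullBranch_eq S α v (n + 1), Finset.sum_range_succ,
    Finset.sum_range_succ, hsum, hseg]
  module

theorem fullBranch_apply [DecidableEq (Λ × List Bool)] (α : Λ) (u : I) (τ : Λ × List Bool) (L : ℕ)
    (h : S.base α τ = 0) :
    fullBranch p S α u (τ, L) = residue p L
      (if τ = (α, initSeg (S.branch u) τ.2.length) then p ^ S.depth α τ.2.length • 1 else 0) := by
  classical
  rw [fullBranch, Pi.smul_apply, branchElt_apply S _ _ _ _ _ h, ← residue_smul]
  simp only [Nat.zero_le, and_true]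
  split_ifs with hc
  · rw [smul_smul, ← pow_add,
      Nat.add_sub_cancel' ((S.depth_strictMono α).monotone (Nat.zero_le _))]
  · simp

/-- Multiplied by `p ^ depth α n`, the branch element at level `n` differs from the full branch only
by finitely many nodes and multiples of the base. -/
theorem exists_pow_smul_eq_sum {x : Ambient p A Λ} (hx : x ∈ spanOn p S Set.univ) :
    ∃ (k : ℕ) (b : Λ × List Bool →₀ A) (f : Λ × I →₀ A),
      p ^ k • x = (b.sum fun τ a => a • node p A τ) +
        f.sum fun q a => a • fullBranch p S q.1 q.2 := by
  set N := Submodule.span A (Set.range (node (Λ := Λ) p A)) with hN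
  set Q := Submodule.span A (Set.range fun q : Λ × I => fullBranch p S q.1 q.2) with hQ
  suffices h : ∃ k : ℕ, p ^ k • x ∈ N ⊔ Q by
    obtain ⟨k, hk⟩ := h
    obtain ⟨y, hy, z, hz, e⟩ := Submodule.mem_sup.1 hk
    obtain ⟨b, rfl⟩ := Finsupp.mem_span_range_iff_exists_finsupp.1 hy
    obtain ⟨f, rfl⟩ := Finsupp.mem_span_range_iff_exists_finsupp.1 hz
    exact ⟨k, b, f, e.symm⟩
  have hnode : ∀ τ, node p A τ ∈ N := fun τ => Submodule.subset_span ⟨τ, rfl⟩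
  induction hx using Submodule.span_induction with
  | mem x hx =>
    rcases hx with ⟨τ, rfl⟩ | ⟨α, u, -, n, rfl⟩
    · exact ⟨0, by simpa using Submodule.mem_sup_left (hnode τ)⟩
    · refine ⟨S.depth α n, ?_⟩
      rw [← sub_eq_iff_eq_add'.2 (fullBranch_eq (p := p) S α u n)]
      refine Submodule.sub_mem _ (Submodule.mem_sup_right (Submodule.subset_span ⟨(α, u), rfl⟩))
        (Submodule.mem_sup_left (Submodule.sum_mem _ fun m _ => ?_))
      refine Submodule.smul_of_tower_mem _ _ (Submodule.add_mem _ (hnode _)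
        (Submodule.smul_of_tower_mem _ _ ?_))
      rw [constFamily_base]
      exact Submodule.sum_mem _ fun τ _ => Submodule.smul_mem _ _ (hnode τ)
  | zero => exact ⟨0, by simp⟩
  | add x y _ _ hx hy =>
    obtain ⟨k, hk⟩ := hx
    obtain ⟨l, hl⟩ := hy
    refine ⟨k + l, ?_⟩
    have e : p ^ (k + l) • (x + y) = p ^ l • p ^ k • x + p ^ k • p ^ l • y := by
      rw [smul_add, smul_smul, smul_smul, ← pow_add, ← pow_add, add_comm l k]
    rw [e]
    exact Submodule.add_mem _ (Submodule.smul_of_tower_mem _ _ hk)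
      (Submodule.smul_of_tower_mem _ _ hl)
  | smul a x _ hx =>
    obtain ⟨k, hk⟩ := hx
    exact ⟨k, by rw [smul_comm]; exact Submodule.smul_mem _ _ hk⟩

/-- A representation of a multiple of `x` by nodes and branches in which the branches are told apart
by their initial segments of length `n₀`; the remaining data `W` selects the branches. -/
structure NormalForm (p : R) (S : BranchSystem A Λ I) (x : Ambient p A Λ) (k n₀ : ℕ)
    (b h : Λ × List Bool →₀ A) (W : Λ × List Bool → I) : Prop where
  eq : p ^ k • x = (b.sum fun τ a => a • node p A τ) +
    h.sum fun τ a => a • fullBranch p S τ.1 (W τ)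
  seg : ∀ τ ∈ h.support, initSeg (S.branch (W τ)) n₀ = τ.2
  length_le : ∀ τ ∈ b.support, τ.2.length ≤ n₀
  base_length_le : ∀ τ ∈ h.support, ∀ σ ∈ (S.base τ.1).support, σ.2.length ≤ n₀

/-- Moving the coefficients from branches to initial segments makes `(k, n₀, b, h)` independent of
`I`, which is what the pigeonhole argument needs. The length `n₀` is chosen past all separation
levels, so no two branches are merged. -/
theorem exists_normalForm [Nonempty I] {x : Ambient p A Λ} (hx : x ∈ spanOn p S Set.univ)
    (n₁ : ℕ) : ∃ k n₀ b h W, n₁ ≤ n₀ ∧ NormalForm p S x k n₀ b h W := by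
  classical
  obtain ⟨k, b, f, e⟩ := exists_pow_smul_eq_sum S hx
  set C : Set I := Prod.snd '' (f.support : Set (Λ × I)) with hC
  have hCfin : C.Finite := f.support.finite_toSet.image _
  obtain ⟨t, ht⟩ := exists_threshold S hCfin.countable
  obtain ⟨m₁, hm₁⟩ := (hCfin.image t).bddAbove
  obtain ⟨m₂, hm₂⟩ := (b.support.finite_toSet.image fun τ => τ.2.length).bddAbove
  obtain ⟨m₃, hm₃⟩ := ((f.support.biUnion fun q => (S.base q.1).support).finite_toSet.image
    fun τ => τ.2.length).bddAbove
  set n₀ := n₁ + m₁ + m₂ + m₃ with hn₀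
  set ρ : Λ × I → Λ × List Bool := fun q => (q.1, initSeg (S.branch q.2) n₀) with hρ
  have hinj : ∀ q ∈ f.support, ∀ q' ∈ f.support, ρ q = ρ q' → q = q' := by
    intro q hq q' hq' h
    have hqC : q.2 ∈ C := ⟨q, hq, rfl⟩
    have hqC' : q'.2 ∈ C := ⟨q', hq', rfl⟩
    have h1 : t q.2 ≤ m₁ := hm₁ ⟨_, hqC, rfl⟩
    have h2 : t q'.2 ≤ m₁ := hm₁ ⟨_, hqC', rfl⟩
    exact Prod.ext (Prod.ext_iff.1 h).1
      (ht _ hqC _ hqC' n₀ (by omega) (by omega) (Prod.ext_iff.1 h).2)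
  -- The default value is never used, since `W` is evaluated only on images of the support of `f`.
  set W : Λ × List Bool → I := fun τ =>
    if h : ∃ q ∈ f.support, ρ q = τ then h.choose.2 else Classical.arbitrary I with hW
  have hWρ : ∀ q ∈ f.support, W (ρ q) = q.2 := by
    intro q hq
    have h : ∃ q' ∈ f.support, ρ q' = ρ q := ⟨q, hq, rfl⟩
    have e : W (ρ q) = h.choose.2 := dif_pos h
    rw [e, hinj _ h.choose_spec.1 q hq h.choose_spec.2]
  have hsupp : ∀ τ ∈ (f.mapDomain ρ).support, ∃ q ∈ f.support, ρ q = τ := fun τ hτ =>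
    Finset.mem_image.1 (Finsupp.mapDomain_support hτ)
  refine ⟨k, n₀, b, f.mapDomain ρ, W, by omega, ?_, ?_, ?_, ?_⟩
  · have hmap : ((f.mapDomain ρ).sum fun τ (a : A) => a • fullBranch p S τ.1 (W τ)) =
        f.sum fun q a => a • fullBranch p S (ρ q).1 (W (ρ q)) :=
      Finsupp.sum_mapDomain_index (fun τ => zero_smul A _)
        fun τ a₁ a₂ => by rw [add_smul]
    rw [e, hmap]
    congr 1
    refine Finset.sum_congr rfl fun q hq => ?_
    dsimp only
    rw [hWρ q hq]
  · intro τ hτ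
    obtain ⟨q, hq, rfl⟩ := hsupp τ hτ
    rw [hWρ q hq]
  · intro τ hτ
    have : τ.2.length ≤ m₂ := hm₂ ⟨τ, hτ, rfl⟩
    omega
  · intro τ hτ σ hσ
    obtain ⟨q, hq, rfl⟩ := hsupp τ hτ
    have : σ.2.length ≤ m₃ := hm₃ ⟨σ, Finset.mem_coe.2 (Finset.mem_biUnion.2 ⟨q, hq, hσ⟩), rfl⟩
    omega

variable {S}

/-- Beyond length `n₀` neither the nodes of `b` nor the base elements contribute, so the coordinate
sees only the branches through `σ`. -/
theorem NormalForm.apply [DecidableEq (Λ × List Bool)] {x : Ambient p A Λ} {k n₀ : ℕ}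
    {b h : Λ × List Bool →₀ A} {W : Λ × List Bool → I} (H : NormalForm p S x k n₀ b h W)
    {σ : Λ × List Bool} (hσ : n₀ < σ.2.length) (L : ℕ) :
    p ^ k • x (σ, L) = residue p L (p ^ S.depth σ.1 σ.2.length •
      ∑ τ ∈ h.support, if σ = (τ.1, initSeg (S.branch (W τ)) σ.2.length) then h τ else 0) := by
  have e := congrFun H.eq (σ, L)
  rw [Pi.smul_apply, Pi.add_apply, Finsupp.sum, Finsupp.sum, Finset.sum_apply,
    Finset.sum_apply] at e
  rw [e, Finset.sum_eq_zero, zero_add, Finset.smul_sum]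
  · rw [map_sum]
    refine Finset.sum_congr rfl fun τ hτ => ?_
    have hb : S.base τ.1 σ = 0 := by
      by_contra hne
      have := H.base_length_le τ hτ σ (Finsupp.mem_support_iff.2 hne)
      omega
    rw [Pi.smul_apply, fullBranch_apply S _ _ _ _ hb, ← map_smul]
    split_ifs with hc
    · rw [(Prod.ext_iff.1 hc).1]
      simp
    · simp
  · intro τ hτ
    have hne : σ ≠ τ := by
      rintro rfl
      have := H.length_le σ hτ
      omega
    rw [Pi.smul_apply, node_apply_of_ne hne, smul_zero]

/-- If two elements with the same normal form up to the choice of branches are close to each other,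
then the corresponding branches split late. -/
theorem NormalForm.smul_mem_of_split (htor : ∀ (n : ℕ) (a : A), p ^ n • a = 0 → a = 0)
    {x x' ξ z : Ambient p A Λ} {k k' n₀ n₀' : ℕ} {b h b' h' : Λ × List Bool →₀ A}
    {W W' V : Λ × List Bool → I} (H : NormalForm p S x k n₀ b h W)
    (H' : NormalForm p S x' k n₀ b h W') (Hξ : NormalForm p S ξ k' n₀' b' h' V)
    (hn₀ : n₀' ≤ n₀) {r : R} {N N' : ℕ} (hx : x - x' = (r * p ^ N) • ξ + p ^ N' • z)
    {τ : Λ × List Bool} (hτ : τ ∈ h.support) {m : ℕ} (hm : n₀ ≤ m)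
    (hsplit : initSeg (S.branch (W τ)) (m + 1) ≠ initSeg (S.branch (W' τ)) (m + 1))
    (hlt : S.depth τ.1 (m + 1) < N') {l : ℕ} (hlN : l ≤ N)
    (hl : S.depth τ.1 (m + 1) + l ≤ N') : p ^ k' • h τ ∈ powSubmodule p A l := by
  classical
  set σ : Λ × List Bool := (τ.1, initSeg (S.branch (W τ)) (m + 1)) with hσ
  have hσl : σ.2.length = m + 1 := by simp [hσ]
  have e1 := H.apply (σ := σ) (by omega) N'
  have e2 := H'.apply (σ := σ) (by omega) N'
  have e3 := Hξ.apply (σ := σ) (by omega) N'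
  -- At the first node after the split, only the branch `W τ` contributes to `x` and no branch
  -- contributes to `x'`.
  have seg_eq : ∀ τ' ∈ h.support, ∀ w : I, initSeg (S.branch w) n₀ = τ'.2 →
      σ = (τ'.1, initSeg (S.branch w) (m + 1)) → τ' = τ := by
    intro τ' hτ' w hw hc
    have h1 := (Prod.ext_iff.1 hc).1
    have h2 := initSeg_eq_initSeg (show n₀ ≤ m + 1 by omega) (Prod.ext_iff.1 hc).2
    rw [hw, H.seg τ hτ] at h2
    exact Prod.ext h1.symm h2.symm
  rw [hσl, Finset.sum_eq_single_of_mem τ hτ, if_pos rfl] at e1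
  swap
  · intro τ' hτ' hne
    exact if_neg fun hc => hne (seg_eq τ' hτ' _ (H.seg τ' hτ') hc)
  rw [hσl, Finset.sum_eq_zero, smul_zero] at e2
  swap
  · intro τ' hτ'
    refine if_neg fun hc => ?_
    obtain rfl := seg_eq τ' hτ' _ (H'.seg τ' hτ') hc
    exact hsplit (Prod.ext_iff.1 hc).2
  rw [hσl] at e3
  set c := ∑ τ' ∈ h'.support, if σ = (τ'.1, initSeg (S.branch (V τ')) (m + 1)) then h' τ' else 0
  have e4 := congrFun hx (σ, N')
  rw [Pi.sub_apply, Pi.add_apply, Pi.smul_apply, Pi.smul_apply,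
    pow_smul_quotient_eq_zero le_rfl, add_zero] at e4
  have e5 : p ^ k' • p ^ k • (x (σ, N') - x' (σ, N')) =
      (p ^ k * (r * p ^ N)) • p ^ k' • ξ (σ, N') := by
    rw [e4, smul_smul, smul_smul, smul_smul]
    congr 1
    ring
  rw [smul_sub, e1, e2, e3, map_zero, sub_zero, ← residue_smul, ← residue_smul,
    residue_eq_residue] at e5
  obtain ⟨d, hd⟩ := e5
  -- Modulo `p ^ N'`, both sides carry the factor `p ^ depth (m + 1)`. After it is cancelled, the
  -- `ξ` term keeps `p ^ N` and the error keeps `p ^ (N' - depth (m + 1))`, both divisible by `p ^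
  -- l`.
  refine ⟨p ^ (N - l) • (p ^ k * r) • c + p ^ (N' - S.depth τ.1 (m + 1) - l) • d, ?_⟩
  rw [← sub_eq_zero]
  apply htor (S.depth τ.1 (m + 1))
  have hN : p ^ N = p ^ l * p ^ (N - l) := by rw [← pow_add, Nat.add_sub_cancel' hlN]
  have hN' : p ^ N' = p ^ S.depth τ.1 (m + 1) * p ^ l *
      p ^ (N' - S.depth τ.1 (m + 1) - l) := by
    rw [← pow_add, ← pow_add]; congr 1; omega
  rw [hN, hN', hσ] at hd
  simp only at hd
  rw [← sub_eq_zero] at hd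
  rw [← hd]
  module

end NormalForm

/-! ### Approximating an endomorphism on base elements -/

section Endomorphism

variable {R : Type u} [CommRing R] {p : R} {A : Type v} [Ring A] [Algebra R A] {Λ I : Type v}
  {S : BranchSystem A Λ I}

/-- The ambient product has `p`-torsion, but `x` lies in the span over finitely many branches, which
is free over `A`. -/
theorem eq_zero_of_pow_smul_eq_zero (hsep : ∀ a : A, (∀ L, a ∈ powSubmodule p A L) → a = 0)
    (htor : ∀ (n : ℕ) (a : A), p ^ n • a = 0 → a = 0) {x : Ambient p A Λ}
    (hx : x ∈ spanOn p S Set.univ) {n : ℕ} (h : p ^ n • x = 0) : x = 0 := by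
  obtain ⟨C, hC, hxC⟩ := exists_finite_mem_spanOn S hx
  have := free_spanOn S hsep hC.countable
  set b := Module.Free.chooseBasis A (spanOn p S C)
  set y : spanOn p S C := ⟨x, hxC⟩ with hy
  have hy0 : algebraMap R A (p ^ n) • y = 0 := by
    rw [algebraMap_smul]
    exact Subtype.ext h
  have : y = 0 := by
    apply b.repr.injective
    rw [map_zero]
    ext i
    apply htor n
    have := DFunLike.congr_fun (congrArg b.repr hy0) i
    rwa [map_smul, Finsupp.smul_apply, map_zero, Finsupp.zero_apply, smul_eq_mul,
      ← Algebra.smul_def] at this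
  exact congrArg Subtype.val this

/-- The branch module is Hausdorff in the `p`-adic topology. -/
theorem eq_zero_of_forall_exists_pow_smul {x : Ambient p A Λ}
    (h : ∀ n : ℕ, ∃ z : Ambient p A Λ, x = p ^ n • z) : x = 0 := by
  ext ⟨τ, L⟩
  obtain ⟨z, rfl⟩ := h L
  exact pow_smul_quotient_eq_zero le_rfl _

theorem exists_split {u v : ℕ → Bool} (h : u ≠ v) : ∃ m, (∀ i < m, u i = v i) ∧ u m ≠ v m := by
  classical
  have hex := Function.ne_iff.1 h
  exact ⟨Nat.find hex, fun i hi => not_not.1 (Nat.find_min hex hi), Nat.find_spec hex⟩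

/-- There are only finitely many initial segments of length `n₁`. -/
theorem exists_late_split {T : Set I} (hT : T.Infinite) (n₁ : ℕ) :
    ∃ u ∈ T, ∃ v ∈ T, ∃ n ≥ n₁, (∀ i < n, S.branch u i = S.branch v i) ∧
      S.branch u n ≠ S.branch v n := by
  have := hT.to_subtype
  obtain ⟨u, v, huv, h⟩ := Finite.exists_ne_map_eq_of_infinite
    (fun u : T => fun i : Fin n₁ => S.branch u i)
  obtain ⟨n, h1, h2⟩ := exists_split (S.branch_injective.ne (Subtype.coe_injective.ne huv))
  refine ⟨u, u.2, v, v.2, n, ?_, h1, h2⟩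
  by_contra hn
  exact h2 (congrFun h ⟨n, by omega⟩)

theorem bit_sub_bit_mem (a b : Bool) :
    ((if a then (1 : R) else 0) - if b then (1 : R) else 0) ∈ ({0, 1, -1} : Set R) := by
  cases a <;> cases b <;> simp

theorem bit_sub_bit_sq {a b : Bool} (h : a ≠ b) :
    ((if a then (1 : R) else 0) - if b then (1 : R) else 0) *
      ((if a then (1 : R) else 0) - if b then (1 : R) else 0) = 1 := by
  cases a <;> cases b <;> simp_all

/-- The image of a base element, up to a power of `p`, is approximated by its multiples. -/
theorem exists_approx_of_split (hsep : ∀ a : A, (∀ L, a ∈ powSubmodule p A L) → a = 0)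
    (htor : ∀ (n : ℕ) (a : A), p ^ n • a = 0 → a = 0)
    (φ : Module.End R (spanOn p S Set.univ)) (α : Λ)
    {k k' n₀ n₀' : ℕ} {b h b' h' : Λ × List Bool →₀ A} {W W' V : Λ × List Bool → I} {u u' : I}
    (H : NormalForm p S (φ ⟨_, fullBranch_mem S α u⟩ : Ambient p A Λ) k n₀ b h W)
    (H' : NormalForm p S (φ ⟨_, fullBranch_mem S α u'⟩ : Ambient p A Λ) k n₀ b h W')
    (Hg : NormalForm p S (φ ⟨_, constFamily_base_mem_spanOn S Set.univ α⟩ : Ambient p A Λ)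
      k' n₀' b' h' V) (hn₀ : n₀' ≤ n₀) {n : ℕ}
    (hun : ∀ i < n, S.branch u i = S.branch u' i) (hne : S.branch u n ≠ S.branch u' n)
    (hdiv : ∀ τ ∈ h.support, p ^ k' • h τ ∉ powSubmodule p A n)
    (hint : ∀ τ ∈ h.support, ∀ m, S.depth α (n + 1) ≤ S.depth τ.1 (m + 1) →
      (α = τ.1 ∧ m = n) ∨ S.depth α n + n ≤ S.depth τ.1 m) :
    ∃ d : Λ × List Bool → R, (∀ τ, d τ ∈ ({0, 1, -1} : Set R)) ∧
      ∃ z ∈ spanOn p S Set.univ,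
        p ^ k • (φ ⟨_, constFamily_base_mem_spanOn S Set.univ α⟩ : Ambient p A Λ) =
          (∑ τ ∈ h.support, d τ • h τ) • constFamily p (S.base α) + p ^ n • z := by
  classical
  set g := constFamily p (S.base α) with hg
  set γ : spanOn p S Set.univ := ⟨g, constFamily_base_mem_spanOn S Set.univ α⟩ with hγ
  set r : R := (if S.branch u n then (1 : R) else 0) - if S.branch u' n then (1 : R) else 0 with hr
  set N := S.depth α n with hN
  set N' := S.depth α (n + 1) with hN'
  have hNN' : N + n < N' := S.depth_add_lt α n
  set ζ : spanOn p S Set.univ := ⟨branchElt p S α u (n + 1) - branchElt p S α u' (n + 1),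
    Submodule.sub_mem _ (branchElt_mem_spanOn S α (Set.mem_univ _) _)
      (branchElt_mem_spanOn S α (Set.mem_univ _) _)⟩ with hζ
  have hφ : (φ ⟨_, fullBranch_mem S α u⟩ : Ambient p A Λ) - φ ⟨_, fullBranch_mem S α u'⟩ =
      (r * p ^ N) • (φ γ : Ambient p A Λ) + p ^ N' • (φ ζ : Ambient p A Λ) := by
    have e : (⟨_, fullBranch_mem S α u⟩ : spanOn p S Set.univ) - ⟨_, fullBranch_mem S α u'⟩ =
        (r * p ^ N) • γ + p ^ N' • ζ := Subtype.ext (fullBranch_sub_fullBranch S α hun)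
    have e' := congrArg (fun y => (φ y : Ambient p A Λ)) e
    simp only [map_sub, map_add, map_smul] at e'
    exact e'
  -- Each pair of branches in the two images contributes a signed multiple of `p ^ N • g`, up to the
  -- error `p ^ (N + n)`.
  have hterm : ∀ τ ∈ h.support, ∃ d ∈ ({0, 1, -1} : Set R), ∃ z ∈ spanOn p S Set.univ,
      fullBranch p S τ.1 (W τ) - fullBranch p S τ.1 (W' τ) =
        (d * p ^ N) • g + p ^ (N + n) • z := by
    intro τ hτ
    by_cases hW : W τ = W' τ
    · exact ⟨0, by simp, 0, Submodule.zero_mem _, by simp [hW]⟩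
    obtain ⟨m, hm, hm'⟩ := exists_split (S.branch_injective.ne hW)
    have hn₀m : n₀ ≤ m := by
      by_contra hlt
      have := (H.seg τ hτ).trans (H'.seg τ hτ).symm
      exact hm' ((initSeg_eq_iff.1 this).2 m (by omega))
    have hsplit : initSeg (S.branch (W τ)) (m + 1) ≠ initSeg (S.branch (W' τ)) (m + 1) :=
      fun e => hm' ((initSeg_eq_iff.1 e).2 m (by omega))
    -- An earlier split would make `p ^ k' • h τ` divisible by `p ^ n`, against `hdiv`.
    have hle : N' ≤ S.depth τ.1 (m + 1) := by
      by_contra! hlt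
      exact hdiv τ hτ (H.smul_mem_of_split htor H' Hg hn₀ hφ hτ hn₀m hsplit hlt
        (S.le_depth α n) (S.depth_gap _ _ _ _ hlt))
    have hyz : branchElt p S τ.1 (W τ) (m + 1) - branchElt p S τ.1 (W' τ) (m + 1) ∈
        spanOn p S Set.univ :=
      Submodule.sub_mem _ (branchElt_mem_spanOn S _ (Set.mem_univ _) _)
        (branchElt_mem_spanOn S _ (Set.mem_univ _) _)
    have e := fullBranch_sub_fullBranch (p := p) S τ.1 hm
    set y := branchElt p S τ.1 (W τ) (m + 1) - branchElt p S τ.1 (W' τ) (m + 1)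
    have hpow : p ^ S.depth τ.1 (m + 1) =
        p ^ (N + n) * p ^ (S.depth τ.1 (m + 1) - (N + n)) := by
      rw [← pow_add]; congr 1; omega
    rw [e, hpow]
    -- Either the split occurs in the tree `α` at the same level and produces `g` itself, or even
    -- its base term is already divisible by `p ^ (N + n)`.
    rcases hint τ hτ m hle with ⟨hα, rfl⟩ | hfar
    · refine ⟨_, bit_sub_bit_mem (S.branch (W τ) m) (S.branch (W' τ) m),
        p ^ (S.depth τ.1 (m + 1) - (N + m)) • y, Submodule.smul_of_tower_mem _ _ hyz, ?_⟩
      rw [← hα, mul_smul (p ^ (N + m))]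
    · have hpow' : p ^ S.depth τ.1 m = p ^ (N + n) * p ^ (S.depth τ.1 m - (N + n)) := by
        rw [← pow_add]; congr 1; omega
      refine ⟨0, by simp, (((if S.branch (W τ) m then (1 : R) else 0) -
          if S.branch (W' τ) m then (1 : R) else 0) * p ^ (S.depth τ.1 m - (N + n))) •
          constFamily p (S.base τ.1) + p ^ (S.depth τ.1 (m + 1) - (N + n)) • y,
        Submodule.add_mem _ (Submodule.smul_of_tower_mem _ _ (constFamily_base_mem_spanOn S _ _))
          (Submodule.smul_of_tower_mem _ _ hyz), ?_⟩
      rw [hpow']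
      module
  choose! d hd z hz hdz using hterm
  have hsum : p ^ k • ((r * p ^ N) • (φ γ : Ambient p A Λ) + p ^ N' • (φ ζ : Ambient p A Λ)) =
      p ^ N • (∑ τ ∈ h.support, d τ • h τ) • g + p ^ (N + n) • ∑ τ ∈ h.support, h τ • z τ := by
    rw [← hφ, smul_sub, H.eq, H'.eq, add_sub_add_left_eq_sub, Finsupp.sum, Finsupp.sum,
      ← Finset.sum_sub_distrib, Finset.sum_smul, Finset.smul_sum, Finset.smul_sum,
      ← Finset.sum_add_distrib]
    refine Finset.sum_congr rfl fun τ hτ => ?_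
    rw [← smul_sub, hdz τ hτ, smul_add, smul_comm (h τ), smul_comm (h τ), mul_comm, mul_smul,
      smul_assoc]
  have hzmem : ∑ τ ∈ h.support, h τ • z τ ∈ spanOn p S Set.univ :=
    Submodule.sum_mem _ fun τ hτ => Submodule.smul_mem _ _ (hz τ hτ)
  set s := ∑ τ ∈ h.support, h τ • z τ
  set a := ∑ τ ∈ h.support, d τ • h τ
  -- The sign `r` is its own inverse, so multiplying by `r` isolates `φ γ`; then `p ^ N` is
  -- cancelled by torsion-freeness.
  have hrr : r * r = 1 := bit_sub_bit_sq hne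
  refine ⟨fun τ => if τ ∈ h.support then r * d τ else 0, ?_,
    r • (s - p ^ (k + (N' - (N + n))) • (φ ζ : Ambient p A Λ)),
    Submodule.smul_of_tower_mem _ _ (Submodule.sub_mem _ hzmem
      (Submodule.smul_of_tower_mem _ _ (φ ζ).2)), ?_⟩
  · intro τ
    dsimp only
    split_ifs with hτ
    · have h1 : r ∈ ({0, 1, -1} : Set R) := bit_sub_bit_mem _ _
      have h2 := hd τ hτ
      simp only [Set.mem_insert_iff, Set.mem_singleton_iff] at h1 h2 ⊢
      rcases h1 with h1 | h1 | h1 <;> rcases h2 with h2 | h2 | h2 <;> simp [h1, h2]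
    · simp
  · have ha : ∑ τ ∈ h.support, (if τ ∈ h.support then r * d τ else 0) • h τ = r • a := by
      rw [Finset.smul_sum]
      refine Finset.sum_congr rfl fun τ hτ => ?_
      rw [if_pos hτ, mul_smul]
    rw [ha, ← sub_eq_zero]
    refine eq_zero_of_pow_smul_eq_zero hsep htor (n := N) (Submodule.sub_mem _
      (Submodule.smul_of_tower_mem _ _ (φ γ).2) (Submodule.add_mem _
        (Submodule.smul_mem _ _ γ.2) (Submodule.smul_of_tower_mem _ _
          (Submodule.smul_of_tower_mem _ _ (Submodule.sub_mem _ hzmem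
            (Submodule.smul_of_tower_mem _ _ (φ ζ).2)))))) ?_
    have hpow : p ^ N' = p ^ (N + n) * p ^ (N' - (N + n)) := by
      rw [← pow_add]; congr 1; omega
    rw [hpow] at hsum
    have hsum' := congrArg (fun y => r • y) (sub_eq_zero.2 hsum)
    simp only [smul_zero] at hsum'
    have hga : (r • a) • g = r • a • g := smul_assoc r a g
    have hrφ : (φ γ : Ambient p A Λ) = (r * r) • (φ γ : Ambient p A Λ) := by rw [hrr, one_smul]
    rw [hga, hrφ, ← hsum']
    generalize (φ γ : Ambient p A Λ) = x
    generalize (φ ζ : Ambient p A Λ) = y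
    generalize a • g = w
    module

end Endomorphism

/-! ### Endomorphisms are scalars, and the module is `ℵ₁`-free -/

section Scalar

variable {R : Type u} [CommRing R] {p : R} {A : Type v} [Ring A] [Algebra R A] {Λ I : Type v}
  {S : BranchSystem A Λ I}

theorem finite_signed_sums {ι : Type*} (h : ι →₀ A) :
    {a : A | ∃ d : ι → R, (∀ i, d i ∈ ({0, 1, -1} : Set R)) ∧
      a = ∑ i ∈ h.support, d i • h i}.Finite := by
  have hfin : (Set.univ.pi fun _ : h.support => ({0, 1, -1} : Set R)).Finite :=
    Set.Finite.pi fun _ => by simp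
  refine (hfin.image fun d => ∑ i : h.support, d i • h i).subset ?_
  rintro a ⟨d, hd, rfl⟩
  exact ⟨fun i => d i, fun i _ => hd i, Finset.sum_coe_sort h.support fun i => d i • h i⟩

/-- Every endomorphism maps a base element to a multiple, up to a power of `p`. -/
theorem exists_pow_smul_map_base_eq [Nonempty I]
    (hsep : ∀ a : A, (∀ L, a ∈ powSubmodule p A L) → a = 0)
    (htor : ∀ (n : ℕ) (a : A), p ^ n • a = 0 → a = 0)
    (hfib : ∀ f : I → ℕ × ℕ × (Λ × List Bool →₀ A) × (Λ × List Bool →₀ A),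
      ∃ c, (f ⁻¹' {c}).Infinite)
    (φ : Module.End R (spanOn p S Set.univ)) (α : Λ) :
    ∃ (k : ℕ) (a : A),
      p ^ k • (φ ⟨_, constFamily_base_mem_spanOn S Set.univ α⟩ : Ambient p A Λ) =
        a • constFamily p (S.base α) := by
  obtain ⟨k', n₀', b', h', V, -, Hg⟩ := exists_normalForm S
    (φ ⟨_, constFamily_base_mem_spanOn S Set.univ α⟩).2 0
  have hnf := fun u : I => exists_normalForm S (φ ⟨_, fullBranch_mem S α u⟩).2 n₀'
  choose k n₀ b h W hn H using hnf
  obtain ⟨⟨k, n₀, b, h⟩, hinf⟩ := hfib fun u => (k u, n₀ u, b u, h u)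
  refine ⟨k, ?_⟩
  -- This bounds how late a split must be for the divisibility of coefficients to become
  -- contradictory.
  have hL : ∀ τ ∈ h.support, ∃ L, p ^ k' • h τ ∉ powSubmodule p A L := by
    intro τ hτ
    by_contra! hall
    exact Finsupp.mem_support_iff.1 hτ (htor k' _ (hsep _ hall))
  choose! L hL using hL
  have hI := fun τ : Λ × List Bool => S.depth_interleave α τ.1
  choose J hJ using hI
  obtain ⟨t₁, ht₁⟩ := (h.support.finite_toSet.image L).bddAbove
  obtain ⟨t₂, ht₂⟩ := (h.support.finite_toSet.image J).bddAbove
  set Ξ : Set A := {a : A | ∃ d : Λ × List Bool → R, (∀ i, d i ∈ ({0, 1, -1} : Set R)) ∧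
      a = ∑ i ∈ h.support, d i • h i} with hΞ
  have hΞfin : Ξ.Finite := finite_signed_sums h
  set g := constFamily p (S.base α)
  set x := (φ ⟨_, constFamily_base_mem_spanOn S Set.univ α⟩ : Ambient p A Λ)
  have key : ∀ n₁, ∃ a ∈ Ξ, ∃ z, p ^ k • x = a • g + p ^ n₁ • z := by
    intro n₁
    obtain ⟨u, hu, u', hu', n, hnn, hagree, hne⟩ :=
      exists_late_split (S := S) hinf (n₁ + t₁ + t₂)
    obtain ⟨rfl, rfl, rfl, rfl⟩ : k = _ ∧ n₀ = _ ∧ b = _ ∧ h = _ := by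
      simpa [eq_comm] using hu
    obtain ⟨e1, e2, e3, e4⟩ : _ = _ ∧ _ = _ ∧ _ = _ ∧ _ = _ := by
      simpa using hu'
    have Hu' := H u'
    rw [e1, e2, e3, e4] at Hu'
    obtain ⟨d, hd, z, -, hz⟩ := exists_approx_of_split hsep htor φ α (H u) Hu' Hg (hn u) hagree hne
      (fun τ hτ hmem => hL τ hτ (by
        have : L τ ≤ t₁ := ht₁ ⟨τ, hτ, rfl⟩
        obtain ⟨c, hc⟩ := hmem
        rw [hc]
        exact pow_smul_mem_powSubmodule (by omega) c))
      (fun τ hτ m hm => hJ τ n (by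
        have : J τ ≤ t₂ := ht₂ ⟨τ, hτ, rfl⟩
        omega) m hm)
    refine ⟨_, ⟨d, hd, rfl⟩, p ^ (n - n₁) • z, ?_⟩
    rw [smul_smul, ← pow_add, Nat.add_sub_cancel' (by omega)]
    exact hz
  -- The multiplier `a` may vary with the precision, but it stays in the finite set `Ξ`. If each `a
  -- ∈ Ξ` failed at some precision, the largest of these would contradict `key`; a single `a` valid
  -- at all precisions gives equality by Hausdorffness.
  by_contra! hno
  have hbad : ∀ a ∈ Ξ, ∃ n, ∀ z, p ^ k • x ≠ a • g + p ^ n • z := by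
    intro a _
    by_contra! hall
    refine hno a (sub_eq_zero.1 (eq_zero_of_forall_exists_pow_smul fun n => ?_))
    obtain ⟨z, hz⟩ := hall n
    exact ⟨z, by rw [hz, add_sub_cancel_left]⟩
  choose! n hn using hbad
  obtain ⟨t, ht⟩ := (hΞfin.image n).bddAbove
  obtain ⟨a, ha, z, hz⟩ := key t
  have hat : n a ≤ t := ht ⟨a, ha, rfl⟩
  apply hn a ha (p ^ (t - n a) • z)
  rw [smul_smul, ← pow_add, Nat.add_sub_cancel' hat, hz]

theorem constFamily_add (f g : Λ × List Bool → A) :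
    constFamily p (f + g) = constFamily p f + constFamily p g :=
  funext fun _ => map_add _ _ _

theorem constFamily_smul (a : A) (f : Λ × List Bool → A) :
    constFamily p (a • f) = a • constFamily p f :=
  funext fun x => map_smul (residue p x.2) a (f x.1)

theorem constFamily_smul_of_tower (r : R) (f : Λ × List Bool → A) :
    constFamily p (r • f) = r • constFamily p f :=
  rfl

theorem constFamily_injective (hsep : ∀ a : A, (∀ L, a ∈ powSubmodule p A L) → a = 0) :
    Function.Injective (constFamily p : (Λ × List Bool → A) → Ambient p A Λ) := by
  intro f g hfg
  ext τ
  rw [← sub_eq_zero]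
  refine hsep _ fun L => residue_eq_residue.1 ?_
  exact congrFun hfg (τ, L)

theorem constFamily_single (τ : Λ × List Bool) (a : A) :
    constFamily p (Finsupp.single τ a) = a • node p A τ := by
  classical
  rw [node, ← constFamily_smul]
  congr 1
  ext σ
  simp [Finsupp.single_apply, eq_comm]

variable (p S) in
/-- The inclusion of the free module on the nodes into the branch module. -/
noncomputable def nodeSum : (Λ × List Bool →₀ A) →ₗ[A] spanOn p S Set.univ :=
  Finsupp.linearCombination A fun τ => ⟨node p A τ, node_mem_spanOn S _ τ⟩

theorem coe_nodeSum (b : Λ × List Bool →₀ A) :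
    (nodeSum p S b : Ambient p A Λ) = constFamily p b := by
  induction b using Finsupp.induction_linear with
  | zero => rw [map_zero]; exact (funext fun _ => map_zero _ : constFamily p 0 = 0).symm
  | add f g hf hg =>
    rw [map_add, Submodule.coe_add, hf, hg, Finsupp.coe_add, constFamily_add]
  | single τ a =>
    rw [constFamily_single, nodeSum, Finsupp.linearCombination_single]
    rfl

theorem nodeSum_injective (hsep : ∀ a : A, (∀ L, a ∈ powSubmodule p A L) → a = 0) :
    Function.Injective (nodeSum p S) := by
  intro b c h
  have h' := congrArg Subtype.val h
  rw [coe_nodeSum, coe_nodeSum] at h'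
  exact DFunLike.coe_injective (constFamily_injective hsep h')

/-- The nodes generate a dense submodule. -/
theorem exists_eq_nodeSum_add (x : spanOn p S Set.univ) (n : ℕ) :
    ∃ b z, x = nodeSum p S b + p ^ n • z := by
  suffices h : ∀ y ∈ spanOn p S Set.univ, ∃ b, ∃ z ∈ spanOn p S Set.univ,
      y = nodeSum p S b + p ^ n • z by
    obtain ⟨b, z, hz, e⟩ := h x x.2
    exact ⟨b, ⟨z, hz⟩, Subtype.ext e⟩
  intro y hy
  induction hy using Submodule.span_induction with
  | mem y hy =>
    rcases hy with ⟨τ, rfl⟩ | ⟨α, u, -, m, rfl⟩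
    · refine ⟨Finsupp.single τ 1, 0, Submodule.zero_mem _, ?_⟩
      rw [coe_nodeSum, constFamily_single, one_smul, smul_zero, add_zero]
    · induction n generalizing m with
      | zero => exact ⟨0, _, branchElt_mem_spanOn S α (Set.mem_univ u) m, by simp⟩
      | succ n ih =>
        obtain ⟨b, z, hz, e⟩ := ih (m + 1)
        have hlt := S.depth_strictMono α (show m < m + 1 by omega)
        -- The exponents increase strictly, so one step along the branch gains the missing factor
        -- `p`.
        obtain ⟨d, hd⟩ : ∃ d, S.depth α (m + 1) - S.depth α m = d + 1 :=
          ⟨S.depth α (m + 1) - S.depth α m - 1, by omega⟩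
        refine ⟨Finsupp.single (α, initSeg (S.branch u) m) 1 +
          (if S.branch u m then (1 : R) else 0) • S.base α + p ^ (d + 1) • b, p ^ d • z,
          Submodule.smul_of_tower_mem _ _ hz, ?_⟩
        rw [branchElt_succ, e, hd, coe_nodeSum, coe_nodeSum, Finsupp.coe_add, Finsupp.coe_add,
          constFamily_add, constFamily_add, constFamily_single, one_smul, Finsupp.coe_smul,
          Finsupp.coe_smul, constFamily_smul_of_tower, constFamily_smul_of_tower]
        module
  | zero => exact ⟨0, 0, Submodule.zero_mem _, by simp⟩
  | add y y' _ _ hy hy' =>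
    obtain ⟨b, z, hz, e⟩ := hy
    obtain ⟨b', z', hz', e'⟩ := hy'
    refine ⟨b + b', z + z', Submodule.add_mem _ hz hz', ?_⟩
    rw [e, e', map_add, Submodule.coe_add, smul_add]
    abel
  | smul a y _ hy =>
    obtain ⟨b, z, hz, e⟩ := hy
    refine ⟨a • b, a • z, Submodule.smul_mem _ _ hz, ?_⟩
    rw [e, map_smul, smul_add, smul_comm a]
    rfl

/-- The sum of the two vectors is also an eigenvector up to a power of `p`. Its multiplier is read
off in the coordinate `σ`, where the image of the `τ`-vector does not interfere, and then carried
over to `τ`. -/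
theorem map_single_of_map_single (hsep : ∀ a : A, (∀ L, a ∈ powSubmodule p A L) → a = 0)
    (htor : ∀ (n : ℕ) (a : A), p ^ n • a = 0 → a = 0)
    {φ : Module.End R (spanOn p S Set.univ)}
    (hφ : ∀ b, ∃ (k : ℕ) (a : A), p ^ k • φ (nodeSum p S b) = a • nodeSum p S b)
    {σ τ : Λ × List Bool} (hστ : σ ≠ τ) {a : A}
    (ha : φ (nodeSum p S (Finsupp.single σ 1)) = a • nodeSum p S (Finsupp.single σ 1)) (c : A) :
    φ (nodeSum p S (Finsupp.single τ c)) = a • nodeSum p S (Finsupp.single τ c) := by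
  obtain ⟨k₁, a₁, h₁⟩ := hφ (Finsupp.single τ c)
  obtain ⟨k₂, a₂, h₂⟩ := hφ (Finsupp.single σ 1 + Finsupp.single τ c)
  have htorG : ∀ (n : ℕ) (x : spanOn p S Set.univ), p ^ n • x = 0 → x = 0 := fun n x hx =>
    Subtype.ext (eq_zero_of_pow_smul_eq_zero hsep htor x.2 (congrArg Subtype.val hx))
  have hR : ∀ (r : R) (b : Λ × List Bool →₀ A), nodeSum p S (r • b) = r • nodeSum p S b :=
    fun r b => LinearMap.map_smul_of_tower _ r b
  have e : p ^ k₁ • p ^ k₂ • φ (nodeSum p S (Finsupp.single σ 1 + Finsupp.single τ c)) =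
      (p ^ k₁ * p ^ k₂) • φ (nodeSum p S (Finsupp.single σ 1)) +
        p ^ k₂ • p ^ k₁ • φ (nodeSum p S (Finsupp.single τ c)) := by
    rw [map_add, map_add]
    module
  rw [h₁, h₂, ha, ← (nodeSum p S).map_smul a₁, ← (nodeSum p S).map_smul a₂,
    ← (nodeSum p S).map_smul a, ← hR, ← hR, ← hR, ← map_add] at e
  have e' := DFunLike.congr_fun (nodeSum_injective hsep e) σ
  simp only [Finsupp.smul_apply, Finsupp.add_apply, Finsupp.single_eq_same,
    Finsupp.single_eq_of_ne hστ, mul_zero, smul_zero, add_zero, smul_eq_mul, mul_one] at e'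
  have ha₂ : a₂ = p ^ k₂ • a := by
    rw [← sub_eq_zero]
    apply htor k₁
    rw [smul_sub, e', smul_smul, sub_self]
  rw [← sub_eq_zero]
  apply htorG k₂
  rw [map_add, map_add, ha, ha₂, smul_assoc, smul_add, smul_add, smul_add] at h₂
  rw [smul_sub, add_left_cancel h₂, sub_self]

/-- All endomorphisms of the branch module are scalar multiplications. -/
theorem exists_forall_eq_smul [Nonempty I]
    (hsep : ∀ a : A, (∀ L, a ∈ powSubmodule p A L) → a = 0)
    (htor : ∀ (n : ℕ) (a : A), p ^ n • a = 0 → a = 0)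
    (hfib : ∀ f : I → ℕ × ℕ × (Λ × List Bool →₀ A) × (Λ × List Bool →₀ A),
      ∃ c, (f ⁻¹' {c}).Infinite)
    (hbase : Function.Surjective S.base) [Nonempty Λ]
    (φ : Module.End R (spanOn p S Set.univ)) : ∃ a : A, ∀ x, φ x = a • x := by
  have hφ : ∀ b, ∃ (k : ℕ) (a : A), p ^ k • φ (nodeSum p S b) = a • nodeSum p S b := by
    intro b
    obtain ⟨α, rfl⟩ := hbase b
    obtain ⟨k, a, h⟩ := exists_pow_smul_map_base_eq hsep htor hfib φ α
    have e : (⟨_, constFamily_base_mem_spanOn S Set.univ α⟩ : spanOn p S Set.univ) =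
        nodeSum p S (S.base α) := Subtype.ext (coe_nodeSum _).symm
    rw [e, ← coe_nodeSum] at h
    exact ⟨k, a, Subtype.ext h⟩
  have htorG : ∀ (n : ℕ) (x : spanOn p S Set.univ), p ^ n • x = 0 → x = 0 := fun n x hx =>
    Subtype.ext (eq_zero_of_pow_smul_eq_zero hsep htor x.2 (congrArg Subtype.val hx))
  obtain ⟨α⟩ := ‹Nonempty Λ›
  set σ₀ : Λ × List Bool := (α, []) with hσ₀
  set σ₁ : Λ × List Bool := (α, [true]) with hσ₁
  have hne : σ₀ ≠ σ₁ := by simp [hσ₀, hσ₁]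
  obtain ⟨a, ha⟩ : ∃ a : A, φ (nodeSum p S (Finsupp.single σ₀ 1)) =
      a • nodeSum p S (Finsupp.single σ₀ 1) := by
    obtain ⟨k, a, h⟩ := hφ (Finsupp.single σ₀ 1)
    -- In the coordinate of precision `k`, the left side vanishes. Hence `a` is divisible by `p ^
    -- k`, and this power can be cancelled.
    have h0 := congrFun (congrArg Subtype.val h) (σ₀, k)
    have h1 : residue p k a = 0 := by
      rw [← (nodeSum p S).map_smul, coe_nodeSum] at h0
      have h2 : (p ^ k • φ (nodeSum p S (Finsupp.single σ₀ 1)) :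
        spanOn p S Set.univ).1 (σ₀, k) = 0 := pow_smul_quotient_eq_zero le_rfl _
      rw [h2] at h0
      simpa [constFamily] using h0.symm
    obtain ⟨c, rfl⟩ := residue_eq_zero.1 h1
    refine ⟨c, ?_⟩
    rw [← sub_eq_zero]
    apply htorG k
    rw [smul_sub, h, smul_assoc, sub_self]
  have h₀ := map_single_of_map_single hsep htor hφ hne ha
  -- Since `φ` is only `R`-linear, its value at `c • node σ₀` does not follow from that at `node
  -- σ₀`; a detour through the second node `σ₁` supplies it.
  have h₁ := map_single_of_map_single hsep htor hφ hne.symm (h₀ 1)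
  have hsingle : ∀ τ c, φ (nodeSum p S (Finsupp.single τ c)) =
      a • nodeSum p S (Finsupp.single τ c) := by
    intro τ c
    by_cases hτ : σ₀ = τ
    · rw [← hτ]; exact h₁ c
    · exact map_single_of_map_single hsep htor hφ hτ ha c
  have hsum : ∀ b, φ (nodeSum p S b) = a • nodeSum p S b := by
    intro b
    induction b using Finsupp.induction_linear with
    | zero => simp
    | add f g hf hg => rw [map_add, map_add, hf, hg, smul_add]
    | single τ c => exact hsingle τ c
  refine ⟨a, fun x => sub_eq_zero.1 (Subtype.ext (eq_zero_of_forall_exists_pow_smul fun n => ?_))⟩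
  obtain ⟨b, z, rfl⟩ := exists_eq_nodeSum_add x n
  refine ⟨(φ z - a • z : spanOn p S Set.univ), ?_⟩
  have e : φ (nodeSum p S b + p ^ n • z) - a • (nodeSum p S b + p ^ n • z) =
      p ^ n • (φ z - a • z) := by
    rw [map_add, hsum, map_smul, smul_add, smul_comm a, smul_sub]
    abel
  exact congrArg Subtype.val e

theorem isEndAlgebra_branchModule [Nonempty I]
    (hsep : ∀ a : A, (∀ L, a ∈ powSubmodule p A L) → a = 0)
    (htor : ∀ (n : ℕ) (a : A), p ^ n • a = 0 → a = 0)
    (hfib : ∀ f : I → ℕ × ℕ × (Λ × List Bool →₀ A) × (Λ × List Bool →₀ A),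
      ∃ c, (f ⁻¹' {c}).Infinite)
    (hbase : Function.Surjective S.base) [Nonempty Λ] :
    IsEndAlgebra R A (spanOn p S Set.univ) := by
  refine ⟨fun a b hab => ?_, fun φ => ?_⟩
  · obtain ⟨α⟩ := ‹Nonempty Λ›
    have h := LinearMap.congr_fun hab (nodeSum p S (Finsupp.single (α, []) 1))
    change a • nodeSum p S (Finsupp.single (α, []) 1) =
      b • nodeSum p S (Finsupp.single (α, []) 1) at h
    rw [← map_smul, ← map_smul] at h
    simpa using DFunLike.congr_fun (nodeSum_injective hsep h) (α, [])
  · obtain ⟨a, ha⟩ := exists_forall_eq_smul hsep htor hfib hbase φ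
    exact ⟨a, LinearMap.ext fun x => (ha x).symm⟩

/-- Each element involves finitely many branches, so a countable submodule embeds into a span over
countably many branches. That span is free over `A`, hence over `R`. -/
theorem isCardFree_branchModule [IsDomain R] [IsPrincipalIdealRing R] [Module.Free R A]
    (hsep : ∀ a : A, (∀ L, a ∈ powSubmodule p A L) → a = 0) :
    IsCardFree ℵ₁ R (spanOn p S Set.univ) := by
  intro N hN
  have hcount : Countable N := by
    rwa [← Cardinal.mk_le_aleph0_iff, ← Cardinal.lt_aleph_one_iff]
  have hfin := fun x : N => exists_finite_mem_spanOn S x.1.2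
  choose C hC hmem using hfin
  have := free_spanOn S hsep (Set.countable_iUnion fun x : N => (hC x).countable)
  have : Module.Free R (spanOn p S (⋃ x : N, C x)) := Module.Free.trans (S := A)
  let f : N →ₗ[R] spanOn p S (⋃ x : N, C x) :=
    { toFun := fun x => ⟨x.1.1, spanOn_mono S (Set.subset_iUnion C x) (hmem x)⟩
      map_add' := fun _ _ => rfl
      map_smul' := fun _ _ => rfl }
  have hf : Function.Injective f := by
    intro x y h
    have h' := congrArg (fun z : spanOn p S (⋃ x : N, C x) => z.1) h
    exact Subtype.ext (Subtype.ext h')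
  exact Module.Free.of_injective_of_isPrincipalIdealRing (N := N) f hf

end Scalar

/-! ### Interleaving exponents -/

section Depth

/-- The number with the given binary digits, the most significant one first. -/
def binCode (t : ℕ → Bool) : ℕ → ℕ
  | 0 => 0
  | n + 1 => 2 * binCode t n + (t n).toNat

theorem binCode_lt (t : ℕ → Bool) (n : ℕ) : binCode t n < 2 ^ n := by
  induction n with
  | zero => simp [binCode]
  | succ n ih =>
    have := Bool.toNat_le (t n)
    rw [binCode, pow_succ]
    omega

theorem binCode_le_of_succ {s t : ℕ → Bool} {n : ℕ} (h : binCode s (n + 1) ≤ binCode t (n + 1)) :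
    binCode s n ≤ binCode t n := by
  have h1 := Bool.toNat_le (t n)
  have h2 := Bool.toNat_le (s n)
  simp only [binCode] at h
  omega

theorem eq_of_binCode_eq {s t : ℕ → Bool} {n : ℕ} (h : binCode s n = binCode t n) :
    ∀ i < n, s i = t i := by
  induction n with
  | zero => intro i hi; omega
  | succ n ih =>
    have h1 := Bool.toNat_le (t n)
    have h2 := Bool.toNat_le (s n)
    simp only [binCode] at h
    intro i hi
    rcases Nat.lt_succ_iff_lt_or_eq.1 hi with hi | rfl
    · exact ih (by omega) i hi
    · have h3 : (s i).toNat = (t i).toNat := by omega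
      revert h3
      cases s i <;> cases t i <;> simp

/-- Exponents attached to the levels of a tree; different trees have interleaving exponents whose
distances tend to infinity. -/
def treeDepth (t : ℕ → Bool) (n : ℕ) : ℕ := 8 ^ n + 2 ^ n * binCode t n

/-- The perturbation at level `m` is at most `4 ^ m ≤ 8 ^ m`, so the level dominates the choice of
tree. -/
theorem treeDepth_add_le (s t : ℕ → Bool) {m n : ℕ} (h : m < n) :
    treeDepth s m + n ≤ treeDepth t n := by
  obtain ⟨d, rfl⟩ : ∃ d, n = m + 1 + d := ⟨n - (m + 1), by omega⟩
  have h1 : 2 ^ m * binCode s m ≤ 2 ^ m * 2 ^ m := Nat.mul_le_mul_left _ (binCode_lt s m).le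
  have h2 : 2 ^ m * 2 ^ m ≤ 8 ^ m := by
    rw [← mul_pow]; exact Nat.pow_le_pow_left (by norm_num) m
  have h3 : 8 ^ (m + 1 + d) = 8 * (8 ^ m * 8 ^ d) := by ring
  have h4 : m < 8 ^ m := Nat.lt_pow_self (by norm_num)
  have h5 : d < 8 ^ d := Nat.lt_pow_self (by norm_num)
  have h6 : 8 ^ m ≤ 8 ^ m * 8 ^ d := Nat.le_mul_of_pos_right _ (by positivity)
  have h7 : 8 ^ d ≤ 8 ^ m * 8 ^ d := Nat.le_mul_of_pos_left _ (by positivity)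
  rw [treeDepth, treeDepth, h3]
  omega

theorem treeDepth_add_le_of_binCode_lt {s t : ℕ → Bool} {n : ℕ} (h : binCode s n < binCode t n) :
    treeDepth s n + n ≤ treeDepth t n := by
  have h1 : 2 ^ n * (binCode s n + 1) ≤ 2 ^ n * binCode t n := Nat.mul_le_mul_left _ h
  have h2 : n < 2 ^ n := Nat.lt_two_pow_self
  rw [treeDepth, treeDepth]
  rw [mul_add, mul_one] at h1
  omega

theorem treeDepth_gap {s t : ℕ → Bool} {m n : ℕ}
    (h : treeDepth s (m + 1) < treeDepth t (n + 1)) :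
    treeDepth s (m + 1) + n ≤ treeDepth t (n + 1) := by
  rcases lt_trichotomy m n with hmn | rfl | hmn
  · have := treeDepth_add_le s t (show m + 1 < n + 1 by omega)
    omega
  · have hlt : binCode s (m + 1) < binCode t (m + 1) := by
      rw [treeDepth, treeDepth] at h
      exact lt_of_mul_lt_mul_left (Nat.lt_of_add_lt_add_left h) (Nat.zero_le _)
    have := treeDepth_add_le_of_binCode_lt hlt
    omega
  · have := treeDepth_add_le t s (show n + 1 < m + 1 by omega)
    omega

/-- At equal levels the order is that of the binary codes, and with the most significant digit first
it passes down to level `n`. There, distinct codes give a gap of at least `2 ^ n`, and equal codes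
mean that the first `n` digits agree, which fails for distinct trees once `n` is large. -/
theorem treeDepth_interleave {s t : ℕ → Bool} {m n : ℕ}
    (h : treeDepth t (n + 1) ≤ treeDepth s (m + 1)) :
    (m = n ∧ binCode t n = binCode s n) ∨ treeDepth t n + n ≤ treeDepth s m := by
  rcases lt_trichotomy m n with hmn | rfl | hmn
  · have := treeDepth_add_le s t (show m + 1 < n + 1 by omega)
    omega
  · have hle : binCode t (m + 1) ≤ binCode s (m + 1) := by
      rw [treeDepth, treeDepth] at h
      exact le_of_mul_le_mul_left (Nat.le_of_add_le_add_left h) (by positivity)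
    rcases (binCode_le_of_succ hle).eq_or_lt with e | hlt
    · exact Or.inl ⟨rfl, e⟩
    · exact Or.inr (treeDepth_add_le_of_binCode_lt hlt)
  · have := treeDepth_add_le t s hmn
    exact Or.inr (by omega)

end Depth

/-! ### Existence of the data and cardinalities -/

section Existence

theorem exists_injective_of_mk_le {X : Type v} (h : #X ≤ 2 ^ ℵ₀) :
    ∃ f : X → ℕ → Bool, Function.Injective f := by
  have h' : #X ≤ #(ULift.{v} (ℕ → Bool)) := by simpa using h
  obtain ⟨f⟩ := h'
  exact ⟨fun x => (f x).down, fun x y hxy => f.injective (ULift.down_injective hxy)⟩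

theorem mk_finsupp_node (A : Type v) [Ring A] [Infinite A] :
    #((ℕ × A) × List Bool →₀ A) = #A := by
  have h := Cardinal.aleph0_le_mk A
  have hn : #((ℕ × A) × List Bool) = #A := by
    simp [Cardinal.mk_prod, Cardinal.aleph0_mul_eq h, Cardinal.mul_aleph0_eq h]
  rw [Cardinal.mk_finsupp_of_infinite', hn, max_self]

/-- A branch system in which every finite combination of nodes occurs as a base element. -/
theorem exists_branchSystem (A : Type v) [Ring A] [Infinite A] (hA : #A ≤ 2 ^ ℵ₀) (I : Type v)
    (hI : #I ≤ 2 ^ ℵ₀) :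
    ∃ S : BranchSystem A (ℕ × A) I, Function.Surjective S.base := by
  classical
  obtain ⟨br, hbr⟩ := exists_injective_of_mk_le hI
  have hΛ : #(ℕ × A) ≤ 2 ^ ℵ₀ := by
    simpa [Cardinal.mk_prod, Cardinal.aleph0_mul_eq (Cardinal.aleph0_le_mk A)] using hA
  obtain ⟨t, ht⟩ := exists_injective_of_mk_le hΛ
  obtain ⟨f⟩ : Nonempty (A ≃ ((ℕ × A) × List Bool →₀ A)) :=
    Cardinal.eq.1 (mk_finsupp_node A).symm
  refine ⟨{
    branch := br
    branch_injective := hbr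
    depth := fun α => treeDepth (t α)
    depth_add_lt := fun α n => by
      have := treeDepth_add_le (t α) (t α) (Nat.lt_succ_self n)
      simp only [Nat.succ_eq_add_one] at this
      omega
    depth_gap := fun α β m n h => treeDepth_gap h
    depth_interleave := fun α β => by
      by_cases hαβ : α = β
      · refine ⟨0, fun n _ m h => ?_⟩
        rcases treeDepth_interleave h with h | h
        · exact Or.inl ⟨hαβ, h.1⟩
        · exact Or.inr h
      · obtain ⟨i, hi⟩ := Function.ne_iff.1 (ht.ne hαβ)
        refine ⟨i + 1, fun n hn m h => ?_⟩
        rcases treeDepth_interleave h with h | h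
        · exact absurd (eq_of_binCode_eq h.2 i (by omega)) hi
        · exact Or.inr h
    rank := Prod.fst
    -- The first component of `α` is a rank that may be taken arbitrarily large, so every
    -- combination is eventually admissible; inadmissible pairs get base 0.
    base := fun α => if ∀ τ ∈ (f α.2).support, τ.1.1 < α.1 then f α.2 else 0
    rank_lt_of_mem_support := fun α τ hτ => by
      split_ifs at hτ with h
      · exact h τ hτ
      · simp at hτ }, fun b => ?_⟩
  obtain ⟨j, hj⟩ := (b.support.finite_toSet.image fun τ => τ.1.1).bddAbove
  refine ⟨(j + 1, f.symm b), ?_⟩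
  have h : ∀ τ ∈ b.support, τ.1.1 < j + 1 := fun τ hτ => Nat.lt_succ_of_le (hj ⟨τ, hτ, rfl⟩)
  dsimp only
  rw [Equiv.apply_symm_apply, if_pos h]

variable {R : Type u} [CommRing R] {p : R} {A : Type v} [Ring A] [Algebra R A]

theorem mk_le_mk_branchModule {Λ I : Type v} (S : BranchSystem A Λ I) [Nontrivial A]
    (hsep : ∀ a : A, (∀ L, a ∈ powSubmodule p A L) → a = 0)
    (htor : ∀ (n : ℕ) (a : A), p ^ n • a = 0 → a = 0) (α : Λ) :
    #I ≤ #(spanOn p S Set.univ) := by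
  classical
  refine Cardinal.mk_le_of_injective
    (f := fun u => (⟨_, fullBranch_mem S α u⟩ : spanOn p S Set.univ)) fun u v huv => ?_
  by_contra hne
  obtain ⟨m, -, hm⟩ := exists_split (S.branch_injective.ne hne)
  have hsegne : initSeg (S.branch u) (m + 1) ≠ initSeg (S.branch v) (m + 1) :=
    fun e => hm ((initSeg_eq_iff.1 e).2 m (by omega))
  refine one_ne_zero (htor (S.depth α (m + 1)) (1 : A) (hsep _ fun L => residue_eq_zero.1 ?_))
  have e := congrFun (congrArg Subtype.val huv) ((α, initSeg (S.branch u) (m + 1)), L)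
  have hb : S.base α (α, initSeg (S.branch u) (m + 1)) = 0 := S.base_eq_zero le_rfl
  dsimp only at e
  rw [fullBranch_apply S _ _ _ _ hb, fullBranch_apply S _ _ _ _ hb, if_pos (by simp),
    if_neg (by simpa using hsegne), map_zero] at e
  simpa using e

theorem mk_branchModule_le {I : Type v} (S : BranchSystem A (ℕ × A) I) [Infinite A]
    (hAI : #A ≤ #I) : #(spanOn p S Set.univ) ≤ #I := by
  have h := Cardinal.aleph0_le_mk A
  have h' := h.trans hAI
  let gen : ((ℕ × A) × List Bool) ⊕ ((ℕ × A) × I × ℕ) → Ambient p A (ℕ × A) :=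
    Sum.elim (node p A) fun q => branchElt p S q.1 q.2.1 q.2.2
  have hgen : spanOn p S Set.univ = Submodule.span A (Set.range gen) := by
    rw [spanOn]
    congr 1
    ext x
    simp [gen, eq_comm]
  have hcard : #(((ℕ × A) × List Bool) ⊕ ((ℕ × A) × I × ℕ)) ≤ #I := by
    simp only [Cardinal.mk_sum, Cardinal.mk_prod, Cardinal.mk_eq_aleph0, Cardinal.lift_aleph0,
      Cardinal.lift_id, Cardinal.aleph0_mul_eq h, Cardinal.mul_aleph0_eq h,
      Cardinal.mul_aleph0_eq h', Cardinal.lift_uzero]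
    rw [Cardinal.mul_eq_right h' hAI (Cardinal.mk_ne_zero A)]
    exact Cardinal.add_le_of_le h' hAI le_rfl
  rw [hgen, ← Finsupp.range_linearCombination]
  refine (Cardinal.mk_range_le (f := Finsupp.linearCombination A gen)).trans ?_
  rw [Cardinal.mk_finsupp_of_infinite']
  exact max_le hcard hAI

/-- There are only `|A|` many normal form data, fewer than branches. -/
theorem exists_infinite_fiber [Infinite A] {I : Type v} (hAI : #A < #I)
    (f : I → ℕ × ℕ × ((ℕ × A) × List Bool →₀ A) × ((ℕ × A) × List Bool →₀ A)) :
    ∃ c, (f ⁻¹' {c}).Infinite := by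
  have h := Cardinal.aleph0_le_mk A
  have hc : #(ℕ × ℕ × ((ℕ × A) × List Bool →₀ A) × ((ℕ × A) × List Bool →₀ A)) = #A := by
    rw [Cardinal.mk_prod, Cardinal.mk_prod, Cardinal.mk_prod, mk_finsupp_node]
    simp [Cardinal.mul_eq_self h, Cardinal.aleph0_mul_eq h]
  obtain ⟨c, hfc⟩ := Cardinal.infinite_pigeonhole_card_lt f (by rwa [hc]) (h.trans hAI.le)
  refine ⟨c, Set.infinite_coe_iff.1 (Cardinal.infinite_iff.2 ?_)⟩
  rw [hc] at hfc
  exact h.trans hfc.le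

theorem eq_zero_of_forall_mem_powSubmodule [IsDomain R] [IsPrincipalIdealRing R]
    [Module.Free R A] (hp : ¬IsUnit p) (a : A) (h : ∀ L, a ∈ powSubmodule p A L) : a = 0 := by
  set b := Module.Free.chooseBasis R A
  apply b.repr.injective
  rw [map_zero]
  ext i
  by_contra hne
  obtain ⟨n, hn⟩ := FiniteMultiplicity.of_not_isUnit hp hne
  obtain ⟨c, hc⟩ := h (n + 1)
  apply hn
  rw [hc, map_smul, Finsupp.smul_apply, smul_eq_mul]
  exact dvd_mul_right _ _

/-- A free algebra of cardinality less than `c ≤ 2 ^ ℵ₀` is the endomorphism algebra of an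
`ℵ₁`-free module of cardinality `c`. -/
theorem exists_isCardFree_isEndAlgebra (R : Type u) [CommRing R] [IsDomain R]
    [IsPrincipalIdealRing R] (hR : ¬IsField R) (A : Type v) [Ring A] [Algebra R A] [Nontrivial A]
    [Module.Free R A] (c : Cardinal.{v}) (hAc : #A < c) (hc : c ≤ 2 ^ ℵ₀) :
    ∃ (G : Type v) (_ : AddCommGroup G) (_ : Module R G) (_ : Module A G)
      (_ : IsScalarTower R A G), #G = c ∧ IsCardFree ℵ₁ R G ∧ IsEndAlgebra R A G := by
  obtain ⟨p, hp0, hp⟩ := Ring.exists_not_isUnit_of_not_isField hR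
  have hRinf : Infinite R := by
    by_contra hfin
    rw [not_infinite_iff_finite] at hfin
    exact hR (Finite.isField_of_domain R)
  have hAinf : Infinite A :=
    Infinite.of_injective (fun r : R => r • (1 : A)) (smul_left_injective R one_ne_zero)
  have hsep := eq_zero_of_forall_mem_powSubmodule (A := A) hp
  have htor : ∀ (n : ℕ) (a : A), p ^ n • a = 0 → a = 0 := fun n a h =>
    (smul_eq_zero.1 h).resolve_left (pow_ne_zero n hp0)
  induction c using Cardinal.inductionOn with
  | _ I =>
    have hI : Infinite I := Cardinal.infinite_iff.2 ((Cardinal.aleph0_le_mk A).trans hAc.le)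
    obtain ⟨S, hS⟩ := exists_branchSystem A (hAc.le.trans hc) I hc
    exact ⟨spanOn p S Set.univ, inferInstance, inferInstance, inferInstance, inferInstance,
      le_antisymm (mk_branchModule_le S hAc.le) (mk_le_mk_branchModule S hsep htor (0, 0)),
      isCardFree_branchModule hsep,
      isEndAlgebra_branchModule hsep htor (exists_infinite_fiber hAc) hS⟩

end Existence

end BranchModule

/-! ### Indecomposability and the special cases -/

theorem IsEndAlgebra.isIndecomposableModule {R : Type u} {G : Type v} [CommRing R] [IsDomain R]
    [AddCommGroup G] [Module R G] (h : IsEndAlgebra R R G) : IsIndecomposableModule R G := by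
  constructor
  · by_contra hG
    rw [not_nontrivial_iff_subsingleton] at hG
    exact zero_ne_one (h.1 (LinearMap.ext fun _ => Subsingleton.elim _ _))
  · intro N K hNK
    -- The projection onto a summand is an idempotent scalar, hence 0 or 1 in a domain.
    obtain ⟨e, he⟩ := h.2 (N.projection K hNK)
    have happly : ∀ x, e • x = N.projection K hNK x := LinearMap.congr_fun he
    have hidem : IsIdempotentElem e := by
      apply h.1
      rw [map_mul, he]
      exact Submodule.isIdempotentElem_projection hNK
    rcases IsIdempotentElem.iff_eq_zero_or_one.1 hidem with rfl | rfl
    · refine Or.inl ((Submodule.eq_bot_iff _).2 fun x hx => ?_)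
      have := Submodule.projection_apply_left hNK ⟨x, hx⟩
      rw [← happly, zero_smul] at this
      exact this.symm
    · refine Or.inr ((Submodule.eq_bot_iff _).2 fun x hx => ?_)
      have := (Submodule.projection_apply_eq_zero_iff hNK).2 hx
      rwa [← happly, one_smul] at this

/-- Over a countable principal ideal domain that is not a field there is an indecomposable
`ℵ₁`-free module of cardinality `ℵ₁` whose endomorphisms are the scalars. -/
theorem exists_isIndecomposableModule_isCardFree (R : Type u) [CommRing R] [IsDomain R]
    [IsPrincipalIdealRing R] [Countable R] (hR : ¬IsField R) :
    ∃ (G : Type u) (_ : AddCommGroup G) (_ : Module R G),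
      #G = ℵ₁ ∧ IsCardFree ℵ₁ R G ∧ IsEndAlgebra R R G ∧ IsIndecomposableModule R G := by
  obtain ⟨G, _, m₁, m₂, htower, hcard, hfree, hend⟩ :=
    BranchModule.exists_isCardFree_isEndAlgebra R hR R ℵ₁
      (Cardinal.lt_aleph_one_iff.2 Cardinal.mk_le_aleph0)
      (Cardinal.aleph_one_le_iff.2 (Cardinal.cantor _))
  -- For `A = R` the construction yields two `R`-module structures on `G`; the scalar tower
  -- identifies them.
  obtain rfl : m₁ = m₂ := by
    refine Module.ext' _ _ fun r x => ?_
    have h := htower.smul_assoc r 1 x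
    rw [smul_eq_mul, mul_one] at h
    rw [h]
    exact congrArg _ (m₂.one_smul x).symm
  exact ⟨G, _, m₁, hcard, hfree, hend, hend.isIndecomposableModule⟩

theorem isDiscreteValuationRing_intLocalizedAt (p : ℕ) [hp : Fact p.Prime] :
    IsDiscreteValuationRing (IntLocalizedAt p) := by
  refine IsLocalization.AtPrime.isDiscreteValuationRing_of_dedekind_domain ℤ
    (P := Ideal.span {(p : ℤ)}) ?_ (IntLocalizedAt p)
  rw [Ne, Ideal.span_singleton_eq_bot]
  exact_mod_cast hp.out.ne_zero

theorem countable_intLocalizedAt (p : ℕ) [Fact p.Prime] : Countable (IntLocalizedAt p) :=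
  (IsLocalization.mk'_surjective (Ideal.span {(p : ℤ)}).primeCompl
    (S := IntLocalizedAt p)).countable

theorem theorem3p1 :
    -- every free algebra of cardinality `< c ≤ 2^ℵ₀` is the endomorphism algebra of an
    -- `ℵ₁`-free module of cardinality `c`
    (∀ (R : Type u) [CommRing R] [IsDomain R] [IsPrincipalIdealRing R] [Countable R],
      ¬ IsField R →
      ∀ (A : Type v) [Ring A] [Algebra R A] [Nontrivial A] [Module.Free R A] (c : Cardinal.{v}),
        #A < c → c ≤ 2 ^ ℵ₀ →
        ∃ (G : Type v) (_ : AddCommGroup G) (_ : Module R G) (_ : Module A G)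
          (_ : IsScalarTower R A G),
          #G = c ∧ IsCardFree ℵ₁ R G ∧ IsEndAlgebra R A G) ∧
    -- the case `A = R`, `c = ℵ₁`
    (∀ (R : Type u) [CommRing R] [IsDomain R] [IsPrincipalIdealRing R] [Countable R],
      ¬ IsField R →
      ∃ (G : Type u) (_ : AddCommGroup G) (_ : Module R G),
        #G = ℵ₁ ∧ IsCardFree ℵ₁ R G ∧ IsEndAlgebra R R G ∧ IsIndecomposableModule R G) ∧
    -- the local rings `ℤ_(p)`
    (∀ (p : ℕ) [Fact p.Prime],
      ∃ (G : Type) (_ : AddCommGroup G) (_ : Module (IntLocalizedAt p) G),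
        #G = ℵ₁ ∧ IsCardFree ℵ₁ (IntLocalizedAt p) G ∧
        IsEndAlgebra (IntLocalizedAt p) (IntLocalizedAt p) G ∧
        IsIndecomposableModule (IntLocalizedAt p) G) := by
  refine ⟨fun R _ _ _ _ hR A _ _ _ _ c => BranchModule.exists_isCardFree_isEndAlgebra R hR A c,
    fun R _ _ _ _ hR => exists_isIndecomposableModule_isCardFree R hR, fun p _ => ?_⟩
  have := isDiscreteValuationRing_intLocalizedAt p
  have := countable_intLocalizedAt p
  exact exists_isIndecomposableModule_isCardFree _ (IsDiscreteValuationRing.not_isField _)
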